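/- All groups are finite, and natural numbers are positive. For a natural number $n$, a subgroup $H$ of a group $G$ is called $n$-modularly embedded in $G$ if either $H \trianglelefteq G$, or $G/\mathrm{Core}_G(H)$ is a non-nilpotent group of order $pq^n$ and $|G:H| = p$ for some primes $p$ and $q$; here $\mathrm{Core}_G(H)$ is the intersection of all conjugates of $H$ in $G$. For a fixed natural number $k$, a subgroup $H$ of $G$ is called $k$-submodular in $G$ if there is a chain of subgroups $H = H_0 \le H_1 \le \dots \le H_m = G$ such that, for every $i = 1, \dots, m$, $H_{i-1}$ is $n_i$-modularly embedded in $H_i$ for some natural number $n_i \le k$. A class of groups (closed under isomorphism) is called a homomorph if it is closed under quotients; hereditary if it is closed under subgroups; primitive closed if it contains $G$ whenever it contains $G/\mathrm{Core}_G(M)$ for every maximal subgroup $M$ of $G$; a Schunck class if it is a primitive closed homomorph; a formation if it is a homomorph and, for all $N_1, N_2 \trianglelefteq G$ such that it contains $G/N_1$ and $G/N_2$, it also contains $G/(N_1 \cap N_2)$. A group is supersoluble if it has a finite series of normal subgroups from $1$ to the whole group with cyclic factors. Theorem. Let $k \ge 1$ be a natural number, let $\mathfrak{X}$ be the class of all groups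 $G$ such that every maximal subgroup of $G$ is $k$-submodular in $G$, and let $\mathfrak{Y}$ be the class of all groups $G$ such that every subgroup of $G$ is $k$-submodular in $G$. Then (1) $\mathfrak{X}$ is a Schunck class consisting of supersoluble groups; (2) $\mathfrak{Y}$ is a hereditary formation; (3) a group $G$ belongs to $\mathfrak{X}$ if and only if $G/\Phi(G)$ belongs to $\mathfrak{Y}$, where $\Phi(G)$ is the Frattini subgroup of $G$ (the intersection of all maximal subgroups of $G$, with $\Phi(G) = G$ if $G = 1$). -/

import Mathlib

universe u

/-- `H` is `n`-modularly embedded in `G`: either `H` is normal in `G`, or `G / Core_G(H)` is a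
non-nilpotent group of order `p * q ^ n` with `|G : H| = p`, for some primes `p` and `q`. -/
def IsModularlyEmbedded {G : Type u} [Group G] (n : ℕ) (H : Subgroup G) : Prop :=
  H.Normal ∨
    (¬ Group.IsNilpotent (G ⧸ H.normalCore) ∧
      ∃ p q : ℕ, p.Prime ∧ q.Prime ∧
        Nat.card (G ⧸ H.normalCore) = p * q ^ n ∧ H.index = p)

/-- `H` is `k`-submodular in `G`: there is a chain `H = c 0 ≤ c 1 ≤ ⋯ ≤ c m = G` in which each
`c i` is `n`-modularly embedded in `c (i + 1)` for some natural number `1 ≤ n ≤ k`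
(depending on `i`). -/
def IsKSubmodular {G : Type u} [Group G] (k : ℕ) (H : Subgroup G) : Prop :=
  ∃ (m : ℕ) (c : ℕ → Subgroup G), c 0 = H ∧ c m = ⊤ ∧
    ∀ i < m, c i ≤ c (i + 1) ∧
      ∃ n : ℕ, 1 ≤ n ∧ n ≤ k ∧ IsModularlyEmbedded n ((c i).subgroupOf (c (i + 1)))

/-- `G` is supersoluble: there is a series `1 = N 0 ≤ N 1 ≤ ⋯ ≤ N m = G` of normal subgroups
of `G` with cyclic factors. -/
def IsSupersoluble (G : Type u) [Group G] : Prop :=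
  ∃ (m : ℕ) (N : ℕ → Subgroup G) (_ : ∀ i, (N i).Normal), N 0 = ⊥ ∧ N m = ⊤ ∧
    ∀ i < m, N i ≤ N (i + 1) ∧ IsCyclic (↥(N (i + 1)) ⧸ (N i).subgroupOf (N (i + 1)))

/-- A property of finite groups. A class of finite groups is such a property that is invariant
under isomorphism, see `IsGroupClass`. -/
abbrev FiniteGroupProperty : Type (u + 1) := ∀ (G : Type u) [Group G] [Finite G], Prop

/-- The property defines a class of groups, that is, it is invariant under isomorphism. -/
def IsGroupClass (𝓗 : FiniteGroupProperty.{u}) : Prop :=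
  ∀ (G K : Type u) [Group G] [Finite G] [Group K] [Finite K], Nonempty (G ≃* K) → 𝓗 G → 𝓗 K

/-- A homomorph: a class of groups closed under quotients. -/
structure IsHomomorph (𝓗 : FiniteGroupProperty.{u}) : Prop where
  isGroupClass : IsGroupClass 𝓗
  quotient : ∀ (G : Type u) [Group G] [Finite G] (N : Subgroup G) [N.Normal], 𝓗 G → 𝓗 (G ⧸ N)

/-- Primitive closed: `G` is in the class as soon as `G / Core_G(M)` is in the class for every
maximal subgroup `M` of `G`. -/
def IsPrimitiveClosed (𝓗 : FiniteGroupProperty.{u}) : Prop :=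
  ∀ (G : Type u) [Group G] [Finite G],
    (∀ M : Subgroup G, IsCoatom M → 𝓗 (G ⧸ M.normalCore)) → 𝓗 G

/-- A Schunck class: a primitive closed homomorph. -/
structure IsSchunckClass (𝓗 : FiniteGroupProperty.{u}) : Prop where
  isHomomorph : IsHomomorph 𝓗
  isPrimitiveClosed : IsPrimitiveClosed 𝓗

/-- Hereditary: closed under subgroups. -/
def IsHereditary (𝓗 : FiniteGroupProperty.{u}) : Prop :=
  ∀ (G : Type u) [Group G] [Finite G] (H : Subgroup G), 𝓗 G → 𝓗 H

/-- A formation: a homomorph such that `G / (N₁ ∩ N₂)` is in it whenever `G / N₁` and `G / N₂`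
are. -/
structure IsFormation (𝓗 : FiniteGroupProperty.{u}) : Prop where
  isHomomorph : IsHomomorph 𝓗
  inf : ∀ (G : Type u) [Group G] [Finite G] (N₁ N₂ : Subgroup G) [N₁.Normal] [N₂.Normal],
    𝓗 (G ⧸ N₁) → 𝓗 (G ⧸ N₂) → 𝓗 (G ⧸ (N₁ ⊓ N₂))

/-- The class of all finite groups whose maximal subgroups are all `k`-submodular. -/
def ClassX (k : ℕ) : FiniteGroupProperty.{u} := fun G _ _ =>
  ∀ M : Subgroup G, IsCoatom M → IsKSubmodular k M

/-- The class of all finite groups whose subgroups are all `k`-submodular. -/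
def ClassY (k : ℕ) : FiniteGroupProperty.{u} := fun G _ _ =>
  ∀ H : Subgroup G, IsKSubmodular k H

open scoped Pointwise commutatorElement

/-! Modulo its core, a non-normal modularly embedded subgroup is a Frobenius complement: its
distinct conjugates meet trivially, there is a normal subgroup of order `p`, and the complement, of
order `q ^ n`, acts faithfully on it, so `q ^ n ∣ p - 1`. The trivial intersections make
embeddedness, and hence `k`-submodularity, pass to preimages under homomorphisms. It also passes to
images under surjections, so both classes are homomorphs and 𝔜 is hereditary.

The main device describes 𝔜 by normal sections. Call `R / S` admissible if it is central, or has
prime order and `G` induces on it a group of automorphisms of order dividing `q ^ k`. Then `G / N`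
lies in 𝔜 iff admissible sections join `N` to `G` (`classY_quotient_iff`). Given such a chain,
multiplying `H` by its terms yields modular steps. Conversely, a minimal normal subgroup has prime
order, and it is admissible because some cyclic subgroup inducing the whole action of `G` on it is
`k`-submodular. Admissible chains survive intersection with normal subgroups, which gives the
formation property. In a group of 𝔛 the core of every maximal subgroup has such a chain, hence so
does their intersection `Φ(G)`; this gives (3).

Supersolubility of 𝔛 rests on `card_prime_of_isMinimalNormal`. Since `G'' ≤ Φ(G)`, the subgroup `G'`
is nilpotent and centralises a minimal normal `N`. In the critical case `G'` and `N` are `p`-groups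
and each `g ^ (p * (p - 1))` acts trivially on `N`. So each `g` has an eigenvector over `𝔽_p`, its
eigenspace is normal in `G`, every `g` acts as a scalar, and `|N| = p`. -/

theorem Subgroup.isCoatom_of_index_prime {G : Type u} [Group G] {H : Subgroup G} (h : H.index.Prime) : IsCoatom H := by
  refine ⟨fun h1 => ?_, fun K hK => ?_⟩
  · rw [h1, Subgroup.index_top] at h
    exact Nat.not_prime_one h
  · have h2 := Subgroup.relIndex_mul_index hK.le
    rcases (Nat.dvd_prime h).1 (Dvd.intro_left _ h2) with h3 | h3
    · exact Subgroup.index_eq_one.1 h3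
    · rw [h3] at h2
      have : H.relIndex K = 1 := Nat.eq_of_mul_eq_mul_right h.pos (by rw [h2, one_mul])
      exact absurd (Subgroup.relIndex_eq_one.1 this) (not_le_of_gt hK)

theorem Subgroup.ne_of_not_normal {G : Type u} [Group G] {H : Subgroup G} {p q n : ℕ}
    (hp : p.Prime) (hidx : H.index = p) (hcard : Nat.card H = q ^ n)
    (hN : ¬ H.Normal) : p ≠ q := by
  rintro rfl
  refine hN (Subgroup.normal_of_index_eq_minFac_card ?_)
  rw [← H.card_mul_index, hcard, hidx, ← pow_succ, hp.pow_minFac (Nat.succ_ne_zero n)]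

theorem Subgroup.coprime_card_of_not_normal {G : Type u} [Group G] {H : Subgroup G}
    {p q n : ℕ} (hp : p.Prime) (hq : q.Prime) (hidx : H.index = p)
    (hcard : Nat.card H = q ^ n) (hN : ¬ H.Normal) : p.Coprime (Nat.card H) := by
  rw [hcard]
  exact Nat.Coprime.pow_right _
    ((Nat.coprime_primes hp hq).2 (ne_of_not_normal hp hidx hcard hN))

/-! ### Core-free subgroups of prime index and prime power order. -/

section FrobeniusStructure

variable {G : Type u} [Group G] [Finite G]

theorem IsPGroup.exists_mem_normalizer {q : ℕ} [Fact q.Prime] {H D : Subgroup G}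
    (hH : IsPGroup q H) (hD : D < H) : ∃ h ∈ H, h ∉ D ∧ h ∈ Subgroup.normalizer (D : Set G) := by
  have := hH.isNilpotent
  have h1 := Group.normalizerCondition_of_isNilpotent (G := H) (D.subgroupOf H)
    (lt_top_iff_ne_top.2 (fun h => not_le_of_gt hD (Subgroup.subgroupOf_eq_top.1 h)))
  obtain ⟨x, hx1, hx2⟩ := SetLike.exists_of_lt h1
  refine ⟨x, x.2, fun h => hx2 (Subgroup.mem_subgroupOf.2 h), ?_⟩
  rw [Subgroup.mem_normalizer_iff] at hx1 ⊢
  intro y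
  have hle := hD.le
  constructor
  · intro hy
    have := (hx1 ⟨y, hle hy⟩).1 (Subgroup.mem_subgroupOf.2 hy)
    simpa [Subgroup.mem_subgroupOf] using this
  · intro hy
    have hyH : y ∈ H := by
      have := H.mul_mem (H.mul_mem (H.inv_mem x.2) (hle hy)) x.2
      simpa [mul_assoc] using this
    have := (hx1 ⟨y, hyH⟩).2 (Subgroup.mem_subgroupOf.2 (by simpa using hy))
    simpa [Subgroup.mem_subgroupOf] using this

variable {H : Subgroup G} {p q n : ℕ}

/-- A subgroup of order prime to the index of the Sylow subgroup `H` lies in a conjugate of `H`. -/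
theorem Subgroup.exists_le_conj_of_not_dvd (hp : p.Prime) (hq : q.Prime) (hidx : H.index = p)
    (hcard : Nat.card H = q ^ n) (hN : ¬ H.Normal) {S : Subgroup G} (hS : ¬ p ∣ Nat.card S) :
    ∃ x : G, S ≤ MulAut.conj x • H := by
  have := Fact.mk hq
  have hSd : Nat.card S ∣ q ^ n := by
    have h1 : Nat.card S ∣ q ^ n * p := by
      rw [← hcard, ← hidx, H.card_mul_index]
      exact S.card_subgroup_dvd_card
    exact Nat.Coprime.dvd_of_dvd_mul_right ((hp.coprime_iff_not_dvd.2 hS).symm) h1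
  obtain ⟨j, -, hj⟩ := (Nat.dvd_prime_pow hq).1 hSd
  obtain ⟨Q, hQ⟩ := (IsPGroup.of_card hj).exists_le_sylow
  have hnd : ¬ q ∣ H.index := by
    rw [hidx, Nat.prime_dvd_prime_iff_eq hq hp]
    exact (ne_of_not_normal hp hidx hcard hN).symm
  let P : Sylow q G := (IsPGroup.of_card hcard).toSylow hnd
  obtain ⟨x, hx⟩ := MulAction.exists_smul_eq G P Q
  refine ⟨x, hQ.trans (le_of_eq ?_)⟩
  rw [← hx, Sylow.smul_def, Sylow.pointwise_smul_def]
  rfl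

theorem Subgroup.exists_mul_zpowers (hp : p.Prime) (hq : q.Prime) (hidx : H.index = p)
    (hcard : Nat.card H = q ^ n) (hN : ¬ H.Normal) {P : Subgroup G} (hP : Nat.card P = p) (g : G) :
    ∃ h ∈ H, ∃ z ∈ P, g = h * z := by
  have h1 : IsComplement' H P := isComplement'_of_coprime
    (by rw [hP, ← hidx, H.card_mul_index])
    (by rw [hP]; exact (coprime_card_of_not_normal hp hq hidx hcard hN).symm)
  obtain ⟨⟨a, b⟩, hab⟩ := h1.2 g
  exact ⟨a, a.2, b, b.2, hab.symm⟩

/-- Let `D = H ∩ H^m` have maximal order among the intersections with `m ∉ H`. If an element of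
order `p` normalises `D`, then, as it generates `G` together with `H`, every conjugate of `D` lies
in `H`, so `D` is in the core. -/
theorem Subgroup.inf_conj_eq_bot (hp : p.Prime) (hq : q.Prime) (hidx : H.index = p)
    (hcard : Nat.card H = q ^ n) (hcore : H.normalCore = ⊥) (hN : ¬ H.Normal) {g : G}
    (hg : g ∉ H) : H ⊓ MulAut.conj g • H = ⊥ := by
  have := Fact.mk hq
  have := Fact.mk hp
  have hco := isCoatom_of_index_prime (hidx ▸ hp : H.index.Prime)
  have hnorm : normalizer (H : Set G) = H :=
    (hco.le_iff.1 le_normalizer).resolve_left (fun h => hN (normalizer_eq_top_iff.1 h))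
  have hHp : IsPGroup q H := IsPGroup.of_card hcard
  have hne : ∀ x : G, x ∉ H → MulAut.conj x • H ≠ H := fun x hx h => hx <| by
    rw [← hnorm, mem_normalizer_iff]
    intro y
    conv_rhs => rw [← h]
    rw [← MulAut.conj_apply, ← MulAut.smul_def, smul_mem_pointwise_smul_iff]
  have hcc : ∀ x : G, Nat.card (MulAut.conj x • H : Subgroup G) = Nat.card H := fun x =>
    (Nat.card_congr (H.equivSMul (MulAut.conj x)).toEquiv).symm
  have : Nonempty {x : G // x ∉ H} := ⟨⟨g, hg⟩⟩
  obtain ⟨⟨m, hm⟩, hmax⟩ := Finite.exists_max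
    (fun x : {x : G // x ∉ H} => Nat.card (H ⊓ MulAut.conj x.1 • H : Subgroup G))
  set D := H ⊓ MulAut.conj m • H with hDdef
  suffices hD : D = ⊥ by
    have := hmax ⟨g, hg⟩
    simp only at this
    rw [hD, card_bot] at this
    exact card_eq_one.1 (le_antisymm this Nat.card_pos)
  have hDH : D < H := lt_of_le_of_ne inf_le_left fun h => hne m hm <| by
    have h1 : H ≤ MulAut.conj m • H := h.ge.trans inf_le_right
    exact (eq_of_le_of_card_ge h1 (hcc m).le).symm
  have hDH' : D < MulAut.conj m • H := lt_of_le_of_ne inf_le_right fun h => hne m hm <| by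
    have h1 : MulAut.conj m • H ≤ H := h.ge.trans inf_le_left
    exact eq_of_le_of_card_ge h1 (hcc m).ge
  -- Otherwise `N(D) ≤ H^x` for some `x`. Normalizers grow in `q`-groups: for `x ∉ H` the
  -- intersection `H ∩ H^x` would exceed `D`, and for `x ∈ H` the part of `N(D)` in `H^m` would lie
  -- in `H ∩ H^m = D`.
  have hpN : p ∣ Nat.card (normalizer (D : Set G)) := by
    by_contra hnd
    obtain ⟨x, hx⟩ := exists_le_conj_of_not_dvd hp hq hidx hcard hN hnd
    have hxH : x ∈ H := by
      by_contra hxH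
      obtain ⟨h, h1, h2, h3⟩ := hHp.exists_mem_normalizer hDH
      have hlt : D < H ⊓ MulAut.conj x • H := by
        refine lt_of_le_of_ne (le_inf hDH.le (le_normalizer.trans hx)) fun h4 => h2 ?_
        rw [h4]
        exact ⟨h1, hx h3⟩
      have h5 := hmax ⟨x, hxH⟩
      have h6 := eq_of_le_of_card_ge hlt.le h5
      exact hlt.ne h6
    rw [conj_smul_eq_self_of_mem hxH] at hx
    have hmp : IsPGroup q (MulAut.conj m • H : Subgroup G) := IsPGroup.of_card ((hcc m).trans hcard)
    obtain ⟨h, h1, h2, h3⟩ := hmp.exists_mem_normalizer hDH'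
    exact h2 ⟨hx h3, h1⟩
  obtain ⟨z, hz⟩ := exists_prime_orderOf_dvd_card' p hpN
  have hzp : Nat.card (zpowers (z : G)) = p := by
    rw [Nat.card_zpowers, orderOf_coe, hz]
  rw [eq_bot_iff, ← hcore]
  intro a ha b
  obtain ⟨h, hh, w, hw, rfl⟩ := exists_mul_zpowers hp hq hidx hcard hN hzp b
  have hwN : w ∈ normalizer (D : Set G) := (zpowers_le.2 z.2) hw
  have := (mem_normalizer_iff.1 hwN a).1 ha
  have h2 := H.mul_mem (H.mul_mem hh (hDH.le this)) (H.inv_mem hh)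
  simpa [mul_assoc] using h2

/-- Frobenius' counting argument, elementary here since `G = HP` with `|P| = p`. The `P`-conjugates
of the nontrivial elements of `H` are `p * (q ^ n - 1)` distinct elements outside `P`. So `P` is
exactly their complement, and that set is invariant under conjugation. -/
theorem Subgroup.exists_normal_card_eq_index (hp : p.Prime) (hq : q.Prime) (hidx : H.index = p)
    (hcard : Nat.card H = q ^ n) (hcore : H.normalCore = ⊥) (hN : ¬ H.Normal) :
    ∃ P : Subgroup G, P.Normal ∧ Nat.card P = p := by
  have := Fact.mk hp
  obtain ⟨z, hz⟩ := exists_prime_orderOf_dvd_card' (G := G) p (hidx ▸ H.index_dvd_card)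
  have hzp : Nat.card (zpowers z) = p := by rw [Nat.card_zpowers, hz]
  set P := zpowers z with hPdef
  have hcop := coprime_card_of_not_normal hp hq hidx hcard hN
  have hPH : P ⊓ H = ⊥ := (disjoint_of_coprime_natCard (by rw [hzp]; exact hcop)).eq_bot
  let f : P × {h : H // h ≠ 1} → G := fun x => x.1 * x.2.1 * (x.1 : G)⁻¹
  have hf : Function.Injective f := by
    rintro ⟨a, ⟨h, hh⟩, hh1⟩ ⟨b, ⟨h', hh'⟩, hh1'⟩ hab
    simp only [f] at hab
    have hmem : (b : G)⁻¹ * a ∈ H := by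
      by_contra hc
      have h1 := inf_conj_eq_bot hp hq hidx hcard hcore hN hc
      have h2 : h' ∈ H ⊓ MulAut.conj ((b : G)⁻¹ * a) • H := by
        refine ⟨hh', ?_⟩
        have : h' = MulAut.conj ((b : G)⁻¹ * a) • h := by
          rw [MulAut.smul_def, MulAut.conj_apply]
          calc h' = (b : G)⁻¹ * (b * h' * (b : G)⁻¹) * b := by group
            _ = _ := by rw [← hab]; group
        rw [this]
        exact (smul_mem_pointwise_smul_iff).2 hh
      rw [h1, mem_bot] at h2
      exact hh1' (Subtype.ext h2)
    have h3 : (b : G)⁻¹ * a ∈ P ⊓ H := ⟨P.mul_mem (P.inv_mem b.2) a.2, hmem⟩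
    rw [hPH, mem_bot, inv_mul_eq_one] at h3
    have h4 : b = a := Subtype.ext h3
    subst h4
    have h5 : h = h' := by simpa using hab
    subst h5
    rfl
  have hcardS : (Set.range f).ncard = p * (q ^ n - 1) := by
    rw [← Nat.card_coe_set_eq, Nat.card_range_of_injective hf, Nat.card_prod, hzp, ← hcard]
    congr 1
    have := Fintype.ofFinite H
    classical
    rw [Nat.card_eq_fintype_card, Fintype.card_subtype_compl, Fintype.card_subtype_eq,
      Nat.card_eq_fintype_card]
  have hPS : (P : Set G) ⊆ (Set.range f)ᶜ := by
    rintro a ha ⟨⟨b, ⟨h, hh⟩, hh1⟩, hab⟩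
    simp only [f] at hab
    have h1 : h ∈ P ⊓ H := by
      refine ⟨?_, hh⟩
      have : h = (b : G)⁻¹ * a * b := by rw [← hab]; group
      rw [this]
      exact P.mul_mem (P.mul_mem (P.inv_mem b.2) ha) b.2
    rw [hPH, mem_bot] at h1
    exact hh1 (Subtype.ext h1)
  have hqn : 0 < q ^ n := pow_pos hq.pos n
  have hPeq : (P : Set G) = (Set.range f)ᶜ := by
    refine Set.eq_of_subset_of_ncard_le hPS ?_ (Set.toFinite _)
    rw [Set.ncard_compl, hcardS, ← H.card_mul_index, hcard, hidx, ← Nat.card_coe_set_eq]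
    change _ ≤ Nat.card P
    rw [hzp, Nat.mul_sub, mul_one, mul_comm p]
    have : p ≤ q ^ n * p := Nat.le_mul_of_pos_left p hqn
    omega
  refine ⟨P, ⟨fun a ha g => ?_⟩, hzp⟩
  by_contra hc
  have hc' : g * a * g⁻¹ ∈ Set.range f := by
    by_contra h
    exact hc (by rw [← SetLike.mem_coe, hPeq]; exact h)
  obtain ⟨⟨b, ⟨h, hh⟩, hh1⟩, hab⟩ := hc'
  simp only [f] at hab
  obtain ⟨h', hh', w, hw, hgb⟩ := exists_mul_zpowers hp hq hidx hcard hN hzp ((b : G)⁻¹ * g)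
  refine (hPeq ▸ ha : a ∈ (Set.range f)ᶜ) ⟨⟨⟨w⁻¹, P.inv_mem hw⟩, ⟨⟨h'⁻¹ * h * h',
    H.mul_mem (H.mul_mem (H.inv_mem hh') hh) hh'⟩, fun h1 => hh1 ?_⟩⟩, ?_⟩
  · have h2 : h'⁻¹ * h * h' = 1 := congrArg Subtype.val h1
    refine Subtype.ext ?_
    change h = 1
    calc h = h' * (h'⁻¹ * h * h') * h'⁻¹ := by group
      _ = 1 := by rw [h2]; group
  · simp only [f]
    calc w⁻¹ * (h'⁻¹ * h * h') * w⁻¹⁻¹ = (h' * w)⁻¹ * h * (h' * w) := by group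
      _ = g⁻¹ * (b * h * (b : G)⁻¹) * g := by rw [← hgb]; group
      _ = a := by rw [hab]; group

/-- Elements of `H` centralising `P` lie in the core because `G = HP`. Thus the kernel of the action
on `P` meets `H` trivially, has order at most `|G : H| = p`, and equals `P`. Hence `G / P` embeds in
the abelian group `Aut P` of order `p - 1`. -/
theorem Subgroup.exists_normal_kernel_of_normalCore_eq_bot (hp : p.Prime) (hq : q.Prime)
    (hidx : H.index = p) (hcard : Nat.card H = q ^ n) (hcore : H.normalCore = ⊥)
    (hN : ¬ H.Normal) :
    ∃ P : Subgroup G, P.Normal ∧ Nat.card P = p ∧ _root_.commutator G ≤ P ∧ q ^ n ∣ p - 1 := by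
  obtain ⟨P, hPn, hP⟩ := exists_normal_card_eq_index hp hq hidx hcard hcore hN
  have := Fact.mk hp
  have hcyc : IsCyclic P := isCyclic_of_prime_card hP
  let ψ : G →* (ZMod (Nat.card P))ˣ :=
    (IsCyclic.mulAutMulEquiv P).toMonoidHom.comp MulAut.conjNormal
  have hker : ∀ g, g ∈ ψ.ker ↔ ∀ x ∈ P, g * x * g⁻¹ = x := by
    intro g
    simp only [ψ, MonoidHom.mem_ker, MonoidHom.comp_apply, MulEquiv.coe_toMonoidHom,
      map_eq_one_iff _ (IsCyclic.mulAutMulEquiv P).injective]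
    constructor
    · intro h x hx
      have := congrArg (fun e : MulAut P => ((e ⟨x, hx⟩ : P) : G)) h
      simpa using this
    · intro h
      ext x
      simpa using h x x.2
  have hinf : ψ.ker ⊓ H = ⊥ := by
    rw [eq_bot_iff, ← hcore]
    rintro a ⟨ha, haH⟩ b
    obtain ⟨h, hh, z, hz, rfl⟩ := exists_mul_zpowers hp hq hidx hcard hN hP b
    have h1 := (hker a).1 ha z hz
    have h2 : z * a * z⁻¹ = a := by
      have : a * z = z * a := by simpa using mul_inv_eq_iff_eq_mul.1 h1
      rw [← this]; group
    have h3 : h * z * a * (h * z)⁻¹ = h * (z * a * z⁻¹) * h⁻¹ := by group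
    rw [h3, h2]
    exact H.mul_mem (H.mul_mem hh haH) (H.inv_mem hh)
  have hPker : P ≤ ψ.ker := by
    intro g hg
    rw [hker]
    intro x hx
    have hc : IsMulCommutative P := inferInstance
    have := congrArg Subtype.val (mul_comm' (⟨g, hg⟩ : P) ⟨x, hx⟩)
    rw [show g * x = x * g from this]
    group
  have hkcard : ψ.ker = P := by
    refine (eq_of_le_of_card_ge hPker ?_).symm
    refine le_trans ?_ hP.ge
    have h1 : Nat.card (ψ.ker ⊓ H : Subgroup G) * H.relIndex ψ.ker = Nat.card ψ.ker := by
      rw [inf_comm, ← relIndex_bot_left, ← inf_relIndex_right H,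
        relIndex_mul_relIndex _ _ _ bot_le inf_le_right, relIndex_bot_left]
    rw [hinf, card_bot, one_mul] at h1
    rw [← h1, ← hidx, ← relIndex_top_right]
    exact relIndex_le_of_le_right le_top (by rw [relIndex_top_right]; exact index_ne_zero_of_finite)
  refine ⟨P, hPn, hP, ?_, ?_⟩
  · rw [← hkcard]
    exact Abelianization.commutator_subset_ker ψ
  · have h1 : P.index = q ^ n := by
      have h2 := P.card_mul_index
      rw [← H.card_mul_index, hP, hcard, hidx, mul_comm] at h2
      exact Nat.eq_of_mul_eq_mul_right hp.pos h2
    rw [← h1, ← hkcard, index_ker]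
    refine (Subgroup.card_subgroup_dvd_card _).trans ?_
    rw [hP, Nat.card_eq_fintype_card, ZMod.card_units_eq_totient, Nat.totient_prime hp]

end FrobeniusStructure

/-! ### Modular embeddings under homomorphisms. -/

theorem Subgroup.comap_normalCore_of_surjective {G₁ G₂ : Type*} [Group G₁] [Group G₂]
    {f : G₁ →* G₂} (hf : Function.Surjective f) (H : Subgroup G₂) :
    H.normalCore.comap f = (H.comap f).normalCore := by
  ext a
  constructor
  · intro h c
    have := h (f c)
    simpa using this
  · intro h b
    obtain ⟨c, rfl⟩ := hf b
    simpa using h c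

/-- A uniform reformulation of being `n`-modularly embedded for some `1 ≤ n ≤ k`. -/
def IsModularlyEmbeddedUpTo {G : Type u} [Group G] (k : ℕ) (H : Subgroup G) : Prop :=
  H.Normal ∨ (H.index.Prime ∧ ∃ q : ℕ, q.Prime ∧ H.normalCore.relIndex H ∣ q ^ k)

/-- Non-nilpotency is automatic when `H` is not normal: in a nilpotent group maximal subgroups are
normal. -/
theorem isModularlyEmbeddedUpTo_iff {G : Type u} [Group G] [Finite G] {k : ℕ} (hk : 1 ≤ k)
    {H : Subgroup G} :
    (∃ n : ℕ, 1 ≤ n ∧ n ≤ k ∧ IsModularlyEmbedded n H) ↔ IsModularlyEmbeddedUpTo k H := by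
  have hmul : Nat.card (G ⧸ H.normalCore) = H.normalCore.relIndex H * H.index := by
    rw [Subgroup.relIndex_mul_index H.normalCore_le]; rfl
  constructor
  · rintro ⟨n, -, hnk, h | ⟨-, p, q, hp, hq, hc, rfl⟩⟩
    · exact Or.inl h
    · refine Or.inr ⟨hp, q, hq, ?_⟩
      rw [hmul, mul_comm] at hc
      rw [Nat.eq_of_mul_eq_mul_left hp.pos hc]
      exact pow_dvd_pow q hnk
  · rintro (h | ⟨hp, q, hq, hd⟩)
    · exact ⟨1, le_rfl, hk, Or.inl h⟩
    · by_cases hN : H.Normal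
      · exact ⟨1, le_rfl, hk, Or.inl hN⟩
      obtain ⟨n, hnk, hn⟩ := (Nat.dvd_prime_pow hq).1 hd
      have hn0 : n ≠ 0 := by
        rintro rfl
        rw [pow_zero, Subgroup.relIndex_eq_one] at hn
        exact hN (le_antisymm H.normalCore_le hn ▸ H.normalCore_normal)
      refine ⟨n, Nat.one_le_iff_ne_zero.2 hn0, hnk, Or.inr ⟨fun hnil => hN ?_, H.index, q, hp, hq,
        by rw [hmul, hn, mul_comm], rfl⟩⟩
      have hs := QuotientGroup.mk'_surjective H.normalCore
      have hker : (QuotientGroup.mk' H.normalCore).ker ≤ H := by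
        rw [QuotientGroup.ker_mk']; exact H.normalCore_le
      have h1 : (H.map (QuotientGroup.mk' H.normalCore)).index.Prime := by
        rw [Subgroup.index_map_eq _ hs hker]; exact hp
      have h2 := Subgroup.NormalizerCondition.normal_of_coatom _ Group.normalizerCondition_of_isNilpotent
        (Subgroup.isCoatom_of_index_prime h1)
      have h3 := h2.comap (QuotientGroup.mk' H.normalCore)
      rwa [Subgroup.comap_map_eq_self hker] at h3

/-- Reduction of a non-normal modularly embedded subgroup to the core-free case. -/
theorem IsModularlyEmbeddedUpTo.exists_map_mk {G : Type u} [Group G] {k : ℕ} {M : Subgroup G}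
    (h : IsModularlyEmbeddedUpTo k M) (hN : ¬ M.Normal) :
    ∃ q n : ℕ, q.Prime ∧ n ≤ k ∧ M.index.Prime ∧ M.normalCore.relIndex M = q ^ n ∧
      (M.map (QuotientGroup.mk' M.normalCore)).index = M.index ∧
      Nat.card (M.map (QuotientGroup.mk' M.normalCore)) = q ^ n ∧
      (M.map (QuotientGroup.mk' M.normalCore)).normalCore = ⊥ ∧
      ¬ (M.map (QuotientGroup.mk' M.normalCore)).Normal ∧
      (M.map (QuotientGroup.mk' M.normalCore)).comap (QuotientGroup.mk' M.normalCore) = M := by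
  obtain ⟨hp, q, hq, hd⟩ := h.resolve_left hN
  obtain ⟨n, hnk, hn⟩ := (Nat.dvd_prime_pow hq).1 hd
  have hs := QuotientGroup.mk'_surjective M.normalCore
  have hker : (QuotientGroup.mk' M.normalCore).ker ≤ M := by
    rw [QuotientGroup.ker_mk']; exact M.normalCore_le
  have hcm := Subgroup.comap_map_eq_self hker
  refine ⟨q, n, hq, hnk, hp, hn, Subgroup.index_map_eq _ hs hker, ?_, ?_, fun h2 => hN ?_, hcm⟩
  · rw [← Subgroup.relIndex_ker, QuotientGroup.ker_mk', hn]
  · rw [← Subgroup.map_comap_eq_self_of_surjective hs (Subgroup.normalCore _),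
      Subgroup.comap_normalCore_of_surjective hs, hcm, Subgroup.map_eq_bot_iff,
      QuotientGroup.ker_mk']
  · exact hcm ▸ h2.comap (QuotientGroup.mk' M.normalCore)

section

variable {G : Type u} [Group G] [Finite G] {k : ℕ} {M : Subgroup G}

theorem IsModularlyEmbeddedUpTo.exists_kernel (h : IsModularlyEmbeddedUpTo k M)
    (hN : ¬ M.Normal) :
    ∃ L : Subgroup G, L.Normal ∧ M.normalCore ≤ L ∧ M.normalCore.relIndex L = M.index ∧
      commutator G ≤ L ∧ L.index ∣ M.index - 1 ∧ ∃ q : ℕ, q.Prime ∧ L.index ∣ q ^ k := by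
  obtain ⟨q, n, hq, hnk, hp, hn, h1, h2, h3, h4, h5⟩ := h.exists_map_mk hN
  obtain ⟨P, hPn, hPc, hcomm, hdvd⟩ :=
    Subgroup.exists_normal_kernel_of_normalCore_eq_bot hp hq h1 h2 h3 h4
  have hs := QuotientGroup.mk'_surjective M.normalCore
  have hle : M.normalCore ≤ P.comap (QuotientGroup.mk' M.normalCore) := by
    conv_lhs => rw [← QuotientGroup.ker_mk' M.normalCore]
    exact Subgroup.ker_le_comap _ _
  have hrel : M.normalCore.relIndex (P.comap (QuotientGroup.mk' M.normalCore)) = M.index := by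
    have h6 := Subgroup.relIndex_ker (P.comap (QuotientGroup.mk' M.normalCore))
      (QuotientGroup.mk' M.normalCore)
    rwa [QuotientGroup.ker_mk', Subgroup.map_comap_eq_self_of_surjective hs, hPc] at h6
  have hLi : (P.comap (QuotientGroup.mk' M.normalCore)).index = q ^ n := by
    have e1 := Subgroup.relIndex_mul_index hle
    have e2 := Subgroup.relIndex_mul_index M.normalCore_le
    rw [hrel] at e1
    rw [hn, ← e1, mul_comm] at e2
    exact (Nat.eq_of_mul_eq_mul_left hp.pos e2).symm
  refine ⟨P.comap (QuotientGroup.mk' M.normalCore), hPn.comap _, hle, hrel, ?_, ?_, q, hq, ?_⟩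
  · rw [commutator_def, ← Subgroup.map_le_iff_le_comap, Subgroup.map_commutator]
    exact (Subgroup.commutator_mono le_top le_top).trans hcomm
  · rw [hLi]; exact hdvd
  · rw [hLi]; exact pow_dvd_pow q hnk

theorem IsModularlyEmbeddedUpTo.inf_conj_le_normalCore (h : IsModularlyEmbeddedUpTo k M)
    (hN : ¬ M.Normal) {g : G} (hg : g ∉ M) {a : G} (ha : a ∈ M) (ha' : g⁻¹ * a * g ∈ M) :
    a ∈ M.normalCore := by
  obtain ⟨q, n, hq, hnk, hp, hn, h1, h2, h3, h4, h5⟩ := h.exists_map_mk hN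
  have hg' : QuotientGroup.mk' M.normalCore g ∉ M.map (QuotientGroup.mk' M.normalCore) := by
    rwa [← Subgroup.mem_comap, h5]
  have h6 := Subgroup.inf_conj_eq_bot hp hq h1 h2 h3 h4 hg'
  have h7 : QuotientGroup.mk' M.normalCore a ∈ M.map (QuotientGroup.mk' M.normalCore) ⊓
      MulAut.conj (QuotientGroup.mk' M.normalCore g) • M.map (QuotientGroup.mk' M.normalCore) := by
    refine ⟨Subgroup.mem_map_of_mem _ ha, ?_⟩
    have : QuotientGroup.mk' M.normalCore a = MulAut.conj (QuotientGroup.mk' M.normalCore g) •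
        QuotientGroup.mk' M.normalCore (g⁻¹ * a * g) := by
      rw [MulAut.smul_def, MulAut.conj_apply, ← map_inv, ← map_mul, ← map_mul]
      congr 1
      group
    rw [this]
    exact Subgroup.smul_mem_pointwise_smul_iff.2 (Subgroup.mem_map_of_mem _ ha')
  rw [h6, Subgroup.mem_bot, ← MonoidHom.mem_ker, QuotientGroup.ker_mk'] at h7
  exact h7

/-- Either the relative index of a modularly embedded subgroup in `S` is its full index, or the
intersection with `S` is normal in `S`. -/
theorem IsModularlyEmbeddedUpTo.relIndex_eq_or_normal (h : IsModularlyEmbeddedUpTo k M)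
    (hN : ¬ M.Normal) (S : Subgroup G) :
    M.relIndex S = M.index ∨ ∀ a ∈ M, a ∈ S → ∀ s ∈ S, s * a * s⁻¹ ∈ M := by
  obtain ⟨q, n, hq, hnk, hp, hn, h1, h2, h3, h4, h5⟩ := h.exists_map_mk hN
  -- If `p` divides the order of the image of `S`, it divides the index of the intersection with the
  -- image of `M`, whose order is a power of `q`. Otherwise `S` lies in a conjugate `M^y`: either `y
  -- ∈ M` and `S ≤ M`, or `M ∩ S` lies in the core.
  by_cases hS : M.index ∣ Nat.card (S.map (QuotientGroup.mk' M.normalCore))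
  · left
    refine le_antisymm ?_ ?_
    · rw [← M.relIndex_top_right]
      exact Subgroup.relIndex_le_of_le_right le_top
        (by rw [M.relIndex_top_right]; exact Subgroup.index_ne_zero_of_finite)
    · refine Nat.le_of_dvd (Nat.pos_of_ne_zero fun h0 =>
        Subgroup.index_ne_zero_of_finite (Subgroup.index_eq_zero_of_relIndex_eq_zero h0)) ?_
      have e1 : M.relIndex S = (M.map (QuotientGroup.mk' M.normalCore)).relIndex
          (S.map (QuotientGroup.mk' M.normalCore)) := by
        conv_lhs => rw [← h5, Subgroup.relIndex_comap]
      have e2 := Subgroup.card_mul_index ((M.map (QuotientGroup.mk' M.normalCore)).subgroupOf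
          (S.map (QuotientGroup.mk' M.normalCore)))
      have e3 : M.index.Coprime (Nat.card ((M.map (QuotientGroup.mk' M.normalCore)).subgroupOf
          (S.map (QuotientGroup.mk' M.normalCore)))) := by
        refine Nat.Coprime.coprime_dvd_right ?_
          (Subgroup.coprime_card_of_not_normal hp hq h1 h2 h4)
        exact Subgroup.card_comap_dvd_of_injective _ _ (Subgroup.subtype_injective _)
      rw [← e2] at hS
      rw [e1]
      exact e3.dvd_of_dvd_mul_left hS
  · right
    obtain ⟨x, hx⟩ := Subgroup.exists_le_conj_of_not_dvd hp hq h1 h2 h4 hS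
    obtain ⟨y, rfl⟩ := QuotientGroup.mk'_surjective _ x
    have hSy : ∀ s ∈ S, y⁻¹ * s * y ∈ M := by
      intro s hs
      have h6 := hx (Subgroup.mem_map_of_mem _ hs)
      rw [Subgroup.mem_pointwise_smul_iff_inv_smul_mem, ← map_inv, MulAut.smul_def,
        MulAut.conj_apply, ← map_inv, ← map_inv, ← map_mul, ← map_mul, ← Subgroup.mem_comap,
        h5, inv_inv] at h6
      exact h6
    intro a haM haS s hs
    by_cases hy : y ∈ M
    · have : s ∈ M := by
        have := M.mul_mem (M.mul_mem hy (hSy s hs)) (M.inv_mem hy)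
        simpa [mul_assoc] using this
      exact M.mul_mem (M.mul_mem this haM) (M.inv_mem this)
    · have := h.inf_conj_le_normalCore hN hy haM (hSy a haS)
      exact M.normalCore_le (M.normalCore_normal.conj_mem a this s)

end

theorem Subgroup.Normal.relIndex_dvd_relIndex {G : Type*} [Group G] {C H K : Subgroup G}
    (hC : C.Normal) (hKH : K ≤ H) : C.relIndex K ∣ C.relIndex H := by
  have h1 := Subgroup.relIndex_ker H (QuotientGroup.mk' C)
  have h2 := Subgroup.relIndex_ker K (QuotientGroup.mk' C)
  rw [QuotientGroup.ker_mk'] at h1 h2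
  rw [h1, h2]
  exact Subgroup.card_dvd_of_le (Subgroup.map_mono hKH)

theorem Subgroup.Normal.relIndex_comap_dvd {G₁ G₂ : Type*} [Group G₁] [Group G₂] (f : G₁ →* G₂)
    {C : Subgroup G₂} (hC : C.Normal) (H : Subgroup G₂) :
    (C.comap f).relIndex (H.comap f) ∣ C.relIndex H := by
  rw [Subgroup.relIndex_comap]
  exact hC.relIndex_dvd_relIndex (Subgroup.map_comap_le f H)

theorem IsModularlyEmbeddedUpTo.comap {G₁ G₂ : Type u} [Group G₁] [Group G₂] [Finite G₂] {k : ℕ}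
    {H : Subgroup G₂} (h : IsModularlyEmbeddedUpTo k H) (f : G₁ →* G₂) :
    IsModularlyEmbeddedUpTo k (H.comap f) := by
  by_cases hN : H.Normal
  · exact Or.inl (hN.comap f)
  rcases h.relIndex_eq_or_normal hN f.range with h1 | h1
  · obtain ⟨hp, q, hq, hd⟩ := h.resolve_left hN
    refine Or.inr ⟨by rw [Subgroup.index_comap, h1]; exact hp, q, hq, ?_⟩
    have hle : H.normalCore.comap f ≤ (H.comap f).normalCore := by
      have := H.normalCore_normal.comap f
      exact Subgroup.normal_le_normalCore.2 (Subgroup.comap_mono H.normalCore_le)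
    exact (Subgroup.relIndex_dvd_of_le_left _ hle).trans
      ((H.normalCore_normal.relIndex_comap_dvd f H).trans hd)
  · refine Or.inl ⟨fun a ha s => ?_⟩
    have := h1 (f a) ha ⟨a, rfl⟩ (f s) ⟨s, rfl⟩
    simpa using this

theorem IsModularlyEmbeddedUpTo.of_comap {G₁ G₂ : Type u} [Group G₁] [Group G₂] {k : ℕ}
    {H : Subgroup G₂} {f : G₁ →* G₂} (hf : Function.Surjective f)
    (h : IsModularlyEmbeddedUpTo k (H.comap f)) : IsModularlyEmbeddedUpTo k H := by
  rcases h with h | ⟨hp, q, hq, hd⟩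
  · left
    have := h.map f hf
    rwa [Subgroup.map_comap_eq_self_of_surjective hf] at this
  · rw [Subgroup.index_comap_of_surjective _ hf] at hp
    refine Or.inr ⟨hp, q, hq, ?_⟩
    rwa [← Subgroup.comap_normalCore_of_surjective hf, Subgroup.relIndex_comap,
      Subgroup.map_comap_eq_self_of_surjective hf] at hd

/-! ### Chains of modular steps. -/

theorem Relation.ReflTransGen.exists_seq {α : Type*} {r : α → α → Prop} {a b : α}
    (h : Relation.ReflTransGen r a b) :
    ∃ (m : ℕ) (c : ℕ → α), c 0 = a ∧ c m = b ∧ (∀ i < m, r (c i) (c (i + 1))) := by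
  induction h using Relation.ReflTransGen.head_induction_on with
  | refl => exact ⟨0, fun _ => b, rfl, rfl, fun i hi => absurd hi (Nat.not_lt_zero i)⟩
  | @head x y hxy _ ih =>
    obtain ⟨m, c, h0, hm, hc⟩ := ih
    refine ⟨m + 1, fun i => Nat.casesOn i x c, rfl, hm, fun i hi => ?_⟩
    cases i with
    | zero => change r x (c 0); rwa [h0]
    | succ i => exact hc i (Nat.lt_of_succ_lt_succ hi)

theorem Relation.ReflTransGen.of_seq {α : Type*} {r : α → α → Prop} {m : ℕ} {c : ℕ → α}
    (h : ∀ i < m, r (c i) (c (i + 1))) : Relation.ReflTransGen r (c 0) (c m) := by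
  induction m with
  | zero => exact .refl
  | succ m ih => exact (ih fun i hi => h i (hi.trans m.lt_succ_self)).tail (h m m.lt_succ_self)

/-- One step of a chain witnessing `k`-submodularity. -/
def ModularStep {G : Type u} [Group G] (k : ℕ) (A B : Subgroup G) : Prop :=
  A ≤ B ∧ IsModularlyEmbeddedUpTo k (A.subgroupOf B)

theorem isKSubmodular_iff {G : Type u} [Group G] [Finite G] {k : ℕ} (hk : 1 ≤ k)
    {H : Subgroup G} :
    IsKSubmodular k H ↔ Relation.ReflTransGen (ModularStep k) H ⊤ := by
  constructor
  · rintro ⟨m, c, h0, hm, hc⟩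
    rw [← h0, ← hm]
    exact .of_seq fun i hi => ⟨(hc i hi).1, (isModularlyEmbeddedUpTo_iff hk).1 (hc i hi).2⟩
  · intro h
    obtain ⟨m, c, h0, hm, hc⟩ := h.exists_seq
    exact ⟨m, c, h0, hm, fun i hi =>
      ⟨(hc i hi).1, (isModularlyEmbeddedUpTo_iff hk).2 (hc i hi).2⟩⟩

theorem ModularStep.comap {G₁ G₂ : Type u} [Group G₁] [Group G₂] [Finite G₂] {k : ℕ}
    {A B : Subgroup G₂} (h : ModularStep k A B) (f : G₁ →* G₂) :
    ModularStep k (A.comap f) (B.comap f) :=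
  ⟨Subgroup.comap_mono h.1, h.2.comap (f.subgroupComap B)⟩

theorem IsKSubmodular.comap {G₁ G₂ : Type u} [Group G₁] [Group G₂] [Finite G₁] [Finite G₂] {k : ℕ}
    (hk : 1 ≤ k) {H : Subgroup G₂} (h : IsKSubmodular k H) (f : G₁ →* G₂) :
    IsKSubmodular k (H.comap f) := by
  rw [isKSubmodular_iff hk] at h ⊢
  rw [← Subgroup.comap_top f]
  exact h.lift (Subgroup.comap f) fun A B hAB => hAB.comap f

theorem ModularStep.map {G₁ G₂ : Type u} [Group G₁] [Group G₂] {k : ℕ}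
    {A B : Subgroup G₁} (h : ModularStep k A B) (f : G₁ →* G₂) (hker : f.ker ≤ A) :
    ModularStep k (A.map f) (B.map f) := by
  refine ⟨Subgroup.map_mono h.1, .of_comap (f.subgroupMap_surjective B) ?_⟩
  have : ((A.map f).subgroupOf (B.map f)).comap (f.subgroupMap B) = A.subgroupOf B := by
    ext x
    rw [Subgroup.mem_comap, Subgroup.mem_subgroupOf, Subgroup.mem_subgroupOf]
    change f x ∈ A.map f ↔ _
    rw [← Subgroup.mem_comap, Subgroup.comap_map_eq_self hker]
  rw [this]
  exact h.2

theorem IsKSubmodular.of_comap {G₁ G₂ : Type u} [Group G₁] [Group G₂] [Finite G₁] [Finite G₂]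
    {k : ℕ} (hk : 1 ≤ k) {H : Subgroup G₂} {f : G₁ →* G₂} (hf : Function.Surjective f)
    (h : IsKSubmodular k (H.comap f)) : IsKSubmodular k H := by
  rw [isKSubmodular_iff hk] at h ⊢
  have key : ∀ A : Subgroup G₁, Relation.ReflTransGen (ModularStep k) A ⊤ → f.ker ≤ A →
      Relation.ReflTransGen (ModularStep k) (A.map f) ⊤ := by
    intro A hA
    induction hA using Relation.ReflTransGen.head_induction_on with
    | refl => intro _; rw [Subgroup.map_top_of_surjective f hf]
    | head hAB _ ih => exact fun hker => .head (hAB.map f hker) (ih (hker.trans hAB.1))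
  have := key _ h (Subgroup.ker_le_comap f H)
  rwa [Subgroup.map_comap_eq_self_of_surjective hf] at this

/-- By maximality a chain from `M` stays at `M` until it jumps to `⊤`, so `M ≤ ⊤` is itself one of
its steps. -/
theorem isKSubmodular_iff_of_isCoatom {G : Type u} [Group G] [Finite G] {k : ℕ} (hk : 1 ≤ k)
    {M : Subgroup G} (hM : IsCoatom M) : IsKSubmodular k M ↔ IsModularlyEmbeddedUpTo k M := by
  have htop : ModularStep k M ⊤ ↔ IsModularlyEmbeddedUpTo k M := by
    have hs : Function.Surjective (⊤ : Subgroup G).subtype := fun x => ⟨⟨x, trivial⟩, rfl⟩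
    exact ⟨fun h => h.2.of_comap hs, fun h => ⟨le_top, h.comap _⟩⟩
  rw [isKSubmodular_iff hk, ← htop]
  refine ⟨fun h => ?_, fun h => .single h⟩
  have key : ∀ A : Subgroup G, Relation.ReflTransGen (ModularStep k) A ⊤ → A = M →
      ModularStep k M ⊤ := by
    intro A hA
    induction hA using Relation.ReflTransGen.head_induction_on with
    | refl => exact fun h => absurd h.symm hM.1
    | head hAB _ ih =>
      rintro rfl
      rcases hM.le_iff.1 hAB.1 with h1 | h1
      · exact h1 ▸ hAB
      · exact ih h1
  exact key M h rfl

/-! ### Maximal normal subgroups and chains of normal sections. -/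

theorem Subgroup.commutator_le_of_relIndex_prime {G : Type*} [Group G] {C L : Subgroup G}
    (hC : C.Normal) (h : (C.relIndex L).Prime) : ⁅L, L⁆ ≤ C := by
  have := Fact.mk h
  have hcyc : IsCyclic (L ⧸ C.subgroupOf L) := isCyclic_of_prime_card (p := C.relIndex L) rfl
  have hcomm := Subgroup.Normal.quotient_commutative_iff_commutator_le.1
    (inferInstance : IsMulCommutative (L ⧸ C.subgroupOf L))
  rw [Subgroup.commutator_le]
  intro x hx y hy
  have := hcomm (Subgroup.commutator_mem_commutator (Subgroup.mem_top (⟨x, hx⟩ : L))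
    (Subgroup.mem_top ⟨y, hy⟩))
  exact Subgroup.mem_subgroupOf.1 this

theorem Subgroup.index_prime_of_isCoatom_of_normal {G : Type*} [Group G] [Finite G]
    {M : Subgroup G} (hM : IsCoatom M) (hN : M.Normal) : M.index.Prime := by
  have h1 : M.index ≠ 1 := fun h => hM.1 (Subgroup.index_eq_one.1 h)
  obtain ⟨r, hr, hd⟩ := Nat.exists_prime_and_dvd h1
  have := Fact.mk hr
  obtain ⟨x, hx⟩ := exists_prime_orderOf_dvd_card' (G := G ⧸ M) r hd
  have hs := QuotientGroup.mk'_surjective M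
  have h2 : (Subgroup.zpowers x).comap (QuotientGroup.mk' M) = ⊤ := by
    have hle : M ≤ (Subgroup.zpowers x).comap (QuotientGroup.mk' M) := by
      conv_lhs => rw [← QuotientGroup.ker_mk' M]
      exact Subgroup.ker_le_comap _ _
    refine (hM.le_iff.1 hle).resolve_right fun h => ?_
    have h3 := congrArg (Subgroup.map (QuotientGroup.mk' M)) h
    rw [Subgroup.map_comap_eq_self_of_surjective hs,
      (Subgroup.map_eq_bot_iff _).2 (QuotientGroup.ker_mk' M).ge, Subgroup.zpowers_eq_bot] at h3
    rw [h3, orderOf_one] at hx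
    exact hr.one_lt.ne hx
  have h3 : Subgroup.zpowers x = ⊤ := by
    rw [← Subgroup.map_comap_eq_self_of_surjective hs (Subgroup.zpowers x), h2,
      Subgroup.map_top_of_surjective _ hs]
  have h4 : M.index = r := by
    rw [← hx, ← Nat.card_zpowers, h3, Subgroup.card_top]; rfl
  rwa [h4]

theorem Subgroup.commutator_le_of_isCoatom_of_normal {G : Type*} [Group G] [Finite G]
    {M : Subgroup G} (hM : IsCoatom M) (hN : M.Normal) : _root_.commutator G ≤ M :=
  Subgroup.commutator_le_of_relIndex_prime hN
    (by rw [Subgroup.relIndex_top_right]; exact index_prime_of_isCoatom_of_normal hM hN)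

theorem IsModularlyEmbeddedUpTo.index_prime {G : Type u} [Group G] [Finite G] {k : ℕ}
    {M : Subgroup G} (h : IsModularlyEmbeddedUpTo k M) (hM : IsCoatom M) : M.index.Prime := by
  by_cases hN : M.Normal
  · exact Subgroup.index_prime_of_isCoatom_of_normal hM hN
  · exact (h.resolve_left hN).1

/-- `R / S` is a section of normal subgroups of `G` which is central, or which has prime order and
on which `G` induces a group of automorphisms whose order divides `q ^ k` for some prime `q`. -/
def SectionStep {G : Type u} [Group G] (k : ℕ) (S R : Subgroup G) : Prop :=
  S.Normal ∧ R.Normal ∧ S ≤ R ∧ (⁅R, ⊤⁆ ≤ S ∨ (S.relIndex R).Prime ∧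
    ∃ (q : ℕ) (C : Subgroup G), q.Prime ∧ C.Normal ∧ S ≤ C ∧ ⁅R, C⁆ ≤ S ∧ C.index ∣ q ^ k)

/-- The normal subgroup `N` is joined to `G` by a chain of section steps. -/
def HasSectionChain {G : Type u} [Group G] (k : ℕ) (N : Subgroup G) : Prop :=
  Relation.ReflTransGen (SectionStep k) N ⊤

theorem SectionStep.comap {G₁ G₂ : Type u} [Group G₁] [Group G₂] {k : ℕ} {S R : Subgroup G₂}
    (h : SectionStep k S R) (f : G₁ →* G₂) : SectionStep k (S.comap f) (R.comap f) := by
  obtain ⟨hS, hR, hle, h⟩ := h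
  have hcomm : ∀ (A : Subgroup G₂) (B : Subgroup G₁), B.map f ≤ A → ⁅R, A⁆ ≤ S →
      ⁅R.comap f, B⁆ ≤ S.comap f := by
    intro A B hB hA
    rw [← Subgroup.map_le_iff_le_comap, Subgroup.map_commutator]
    exact (Subgroup.commutator_mono (Subgroup.map_comap_le f R) hB).trans hA
  refine ⟨hS.comap f, hR.comap f, Subgroup.comap_mono hle, ?_⟩
  rcases h with h | ⟨hp, q, C, hq, hC, hSC, hRC, hd⟩
  · exact Or.inl (hcomm ⊤ ⊤ le_top h)
  -- A section of prime order either collapses in the preimage, and is then trivially central, or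
  -- keeps its order.
  · rcases (Nat.dvd_prime hp).1 (hS.relIndex_comap_dvd f R) with h1 | h1
    · have := hR.comap f
      exact Or.inl ((Subgroup.commutator_le_left _ _).trans
        (Subgroup.relIndex_eq_one.1 h1))
    · refine Or.inr ⟨h1 ▸ hp, q, C.comap f, hq, hC.comap f, Subgroup.comap_mono hSC,
        hcomm C _ (Subgroup.map_comap_le f C) hRC, ?_⟩
      rw [Subgroup.index_comap]
      exact (Subgroup.relIndex_dvd_index_of_normal C f.range).trans hd

theorem SectionStep.inf {G : Type u} [Group G] {k : ℕ} {S R : Subgroup G}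
    (h : SectionStep k S R) (N : Subgroup G) (hN : N.Normal) :
    SectionStep k (S ⊓ N) (R ⊓ N) := by
  obtain ⟨hS, hR, hle, h⟩ := h
  have hRN : (R ⊓ N).Normal := inferInstance
  have hcomm : ∀ A : Subgroup G, ⁅R, A⁆ ≤ S → ⁅R ⊓ N, A⁆ ≤ S ⊓ N := fun A hA =>
    le_inf ((Subgroup.commutator_mono inf_le_left le_rfl).trans hA)
      ((Subgroup.commutator_le_left _ _).trans inf_le_right)
  refine ⟨inferInstance, hRN, inf_le_inf_right N hle, ?_⟩
  rcases h with h | ⟨hp, q, C, hq, hC, hSC, hRC, hd⟩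
  · exact Or.inl (hcomm _ h)
  · have h0 : (S ⊓ N).relIndex (R ⊓ N) = S.relIndex (R ⊓ N) := by
      rw [← Subgroup.inf_relIndex_right S, ← inf_assoc, inf_eq_left.2 hle]
    rcases (Nat.dvd_prime hp).1 (hS.relIndex_dvd_relIndex (inf_le_left : R ⊓ N ≤ R)) with h1 | h1
    · refine Or.inl ((Subgroup.commutator_le_left _ _).trans ?_)
      exact Subgroup.relIndex_eq_one.1 (h0.trans h1)
    · exact Or.inr ⟨by rw [h0, h1]; exact hp, q, C, hq, hC, inf_le_left.trans hSC, hcomm C hRC, hd⟩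

theorem HasSectionChain.comap {G₁ G₂ : Type u} [Group G₁] [Group G₂] {k : ℕ} {N : Subgroup G₂}
    (h : HasSectionChain k N) (f : G₁ →* G₂) : HasSectionChain k (N.comap f) := by
  unfold HasSectionChain
  rw [← Subgroup.comap_top f]
  exact h.lift (Subgroup.comap f) fun A B hAB => hAB.comap f

/-- Intersecting the chain above `N₂` with `N₁` joins `N₁ ⊓ N₂` to `N₁`, where the chain above `N₁`
takes over. -/
theorem HasSectionChain.inf {G : Type u} [Group G] {k : ℕ} {N₁ N₂ : Subgroup G}
    (hN₁ : N₁.Normal) (h₁ : HasSectionChain k N₁) (h₂ : HasSectionChain k N₂) :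
    HasSectionChain k (N₁ ⊓ N₂) := by
  have h := h₂.lift (fun A => A ⊓ N₁) fun A B hAB => hAB.inf N₁ hN₁
  change Relation.ReflTransGen _ (N₂ ⊓ N₁) (⊤ ⊓ N₁) at h
  rw [top_inf_eq, inf_comm] at h
  exact h.trans h₁

/-- If `R / S` is central, `R` normalises `H`. Otherwise, unless `R ≤ H`, one has `R ∩ H = S` and
`|HR : H| = |R : S|` is prime. Moreover `H ∩ C` is normal in `HR`, as `R` centralises it modulo `S`,
so the core of `H` in `HR` contains it. -/
theorem SectionStep.modularStep {G : Type u} [Group G] [Finite G] {k : ℕ} {S R : Subgroup G}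
    (h : SectionStep k S R) {H : Subgroup G} (hSH : S ≤ H) : ModularStep k H (H ⊔ R) := by
  obtain ⟨hS, hR, hle, h⟩ := h
  have hconj : ∀ A C : Subgroup G, A ≤ H ⊔ R → A ≤ C → S ≤ A → ⁅R, C⁆ ≤ S →
      (∀ h ∈ H, ∀ a ∈ A, h * a * h⁻¹ ∈ A) → (A.subgroupOf (H ⊔ R)).Normal := by
    intro A C hA hAC hSA hRC hHA
    refine ⟨fun a ha g => ?_⟩
    rw [Subgroup.mem_subgroupOf] at ha ⊢
    obtain ⟨x, hx, r, hr, hg⟩ := Subgroup.mem_sup_of_normal_right.1 g.2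
    have h1 : r * (a : G) * r⁻¹ ∈ A := by
      have h2 : ⁅r, (a : G)⁆ ∈ A := hSA (hRC (Subgroup.commutator_mem_commutator hr (hAC ha)))
      have h3 := A.mul_mem h2 ha
      rwa [commutatorElement_def, inv_mul_cancel_right] at h3
    have h4 := hHA x hx _ h1
    have h5 : ((g * a * g⁻¹ : ↥(H ⊔ R)) : G) = x * (r * (a : G) * r⁻¹) * x⁻¹ := by
      simp only [Subgroup.coe_mul, Subgroup.coe_inv, ← hg]
      group
    rwa [h5]
  have hHH : ∀ h ∈ H, ∀ a ∈ H, h * a * h⁻¹ ∈ H := fun h hh a ha =>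
    H.mul_mem (H.mul_mem hh ha) (H.inv_mem hh)
  refine ⟨le_sup_left, ?_⟩
  rcases h with h | ⟨hp, q, C, hq, hC, hSC, hRC, hd⟩
  · exact Or.inl (hconj H ⊤ le_sup_left le_top hSH h hHH)
  · by_cases hRH : R ≤ H
    · left
      rw [sup_eq_left.2 hRH, Subgroup.subgroupOf_self]
      infer_instance
    have hSR : S = R ⊓ H := by
      have h1 := Subgroup.relIndex_mul_relIndex S (R ⊓ H) R (le_inf hle hSH) inf_le_left
      rcases (Nat.dvd_prime hp).1 (Dvd.intro_left _ h1) with h2 | h2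
      · rw [Subgroup.relIndex_eq_one] at h2
        exact absurd (h2.trans inf_le_right) hRH
      · rw [h2] at h1
        have h3 := Nat.eq_of_mul_eq_mul_right hp.pos (h1.trans (one_mul _).symm)
        exact le_antisymm (le_inf hle hSH) (Subgroup.relIndex_eq_one.1 h3)
    have hidx : H.relIndex (H ⊔ R) = S.relIndex R := by
      have e1 := Subgroup.relIndex_mul_relIndex S H (H ⊔ R) hSH le_sup_left
      have e2 := Subgroup.relIndex_mul_relIndex S R (H ⊔ R) hle le_sup_right
      have e3 : R.relIndex (H ⊔ R) = S.relIndex H := by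
        rw [Subgroup.relIndex_sup_right, hSR, Subgroup.inf_relIndex_right]
      rw [e3, ← e1, mul_comm] at e2
      refine (Nat.eq_of_mul_eq_mul_left (Nat.pos_of_ne_zero fun h0 =>
        Subgroup.index_ne_zero_of_finite (Subgroup.index_eq_zero_of_relIndex_eq_zero h0)) e2).symm
    refine Or.inr ⟨?_, q, hq, ?_⟩
    · change (H.relIndex (H ⊔ R)).Prime
      rwa [hidx]
    · have hn := hconj (H ⊓ C) C (inf_le_left.trans le_sup_left) inf_le_right (le_inf hSH hSC) hRC
        fun h hh a ha => ⟨hHH h hh a ha.1, hC.conj_mem a ha.2 h⟩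
      have hle' : (H ⊓ C).subgroupOf (H ⊔ R) ≤ (H.subgroupOf (H ⊔ R)).normalCore :=
        Subgroup.normal_le_normalCore.2 (Subgroup.comap_mono inf_le_left)
      refine (Subgroup.relIndex_dvd_of_le_left _ hle').trans ?_
      rw [Subgroup.relIndex_subgroupOf le_sup_left, Subgroup.inf_relIndex_left]
      exact (Subgroup.relIndex_dvd_index_of_normal C H).trans hd

theorem HasSectionChain.isKSubmodular {G : Type u} [Group G] [Finite G] {k : ℕ} (hk : 1 ≤ k)
    {N : Subgroup G} (h : HasSectionChain k N) {H : Subgroup G} (hH : N ≤ H) :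
    IsKSubmodular k H := by
  rw [isKSubmodular_iff hk]
  unfold HasSectionChain at h
  induction h using Relation.ReflTransGen.head_induction_on generalizing H with
  | refl => rw [top_le_iff.1 hH]
  | head hSR _ ih => exact .head (hSR.modularStep hH) (ih le_sup_right)

/-- For non-normal `M` the chain is core, Frobenius kernel `L`, `G`: the lower section is
centralised by `L`, the upper one is central since `G' ≤ L`. -/
theorem IsModularlyEmbeddedUpTo.hasSectionChain_normalCore {G : Type u} [Group G] [Finite G]
    {k : ℕ} {M : Subgroup G} (h : IsModularlyEmbeddedUpTo k M) (hM : IsCoatom M) :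
    HasSectionChain k M.normalCore := by
  by_cases hN : M.Normal
  · rw [M.normalCore_eq_self]
    exact .single ⟨hN, inferInstance, le_top,
      Or.inl (Subgroup.commutator_le_of_isCoatom_of_normal hM hN)⟩
  · obtain ⟨L, hL, hle, hrel, hcomm, -, q, hq, hd⟩ := h.exists_kernel hN
    have hp := (h.resolve_left hN).1
    refine .head (b := L) ⟨M.normalCore_normal, hL, hle, Or.inr ⟨hrel ▸ hp, q, L, hq, hL, hle,
      Subgroup.commutator_le_of_relIndex_prime M.normalCore_normal (hrel ▸ hp), hd⟩⟩
      (.single ⟨hL, inferInstance, le_top, Or.inl hcomm⟩)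

theorem hasSectionChain_frattini {G : Type u} [Group G] [Finite G] {k : ℕ}
    (h : ∀ M : Subgroup G, IsCoatom M → IsModularlyEmbeddedUpTo k M) :
    HasSectionChain k (frattini G) := by
  have key : ∀ s : Set (Subgroup G), s ⊆ {M | IsCoatom M} →
      (sInf (Subgroup.normalCore '' s)).Normal ∧
        HasSectionChain k (sInf (Subgroup.normalCore '' s)) := by
    intro s
    refine Set.Finite.induction_on (motive := fun s _ => s ⊆ {M | IsCoatom M} →
      (sInf (Subgroup.normalCore '' s)).Normal ∧
        HasSectionChain k (sInf (Subgroup.normalCore '' s))) s s.toFinite ?_ ?_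
    · intro _
      rw [Set.image_empty, sInf_empty]
      exact ⟨inferInstance, .refl⟩
    · intro M t _ _ ih hs
      rw [Set.insert_subset_iff] at hs
      rw [Set.image_insert_eq, sInf_insert]
      obtain ⟨ih1, ih2⟩ := ih hs.2
      exact ⟨inferInstance, ((h M hs.1).hasSectionChain_normalCore hs.1).inf M.normalCore_normal ih2⟩
  have heq : sInf (Subgroup.normalCore '' {M : Subgroup G | IsCoatom M}) = frattini G := by
    refine le_antisymm ?_ ?_
    · refine le_iInf₂ fun M hM => ?_
      exact (sInf_le (Set.mem_image_of_mem _ hM)).trans M.normalCore_le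
    · refine le_sInf ?_
      rintro _ ⟨M, hM, rfl⟩
      exact Subgroup.normal_le_normalCore.2 (frattini_le_coatom hM)
  rw [← heq]
  exact (key _ le_rfl).2

/-! ### Minimal normal subgroups and supersolubility. -/

/-- For a Sylow subgroup `P` of `K`, the Frattini argument gives `G = N_G(P) K`. Applied in `K` to
the normal subgroup `P K'`, it gives `K ≤ N_G(P) Φ(G)`. Hence `G = N_G(P) Φ(G) = N_G(P)`. -/
theorem Subgroup.isNilpotent_of_commutator_le_frattini {G : Type*} [Group G] [Finite G]
    {K : Subgroup G} (hK : K.Normal) (h : ⁅K, K⁆ ≤ frattini G) : Group.IsNilpotent K := by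
  refine ((Group.isNilpotent_of_finite_tfae (G := K)).out 0 3 rfl rfl).2 ?_
  intro p _ P
  have h1 := Sylow.normalizer_sup_eq_top P
  have hN : ((P : Subgroup K) ⊔ _root_.commutator K).Normal :=
    Subgroup.Normal.of_commutator_le _ le_sup_right
  have h2 := P.normalizer_sup_eq_top' (N := (P : Subgroup K) ⊔ _root_.commutator K) le_sup_left
  have h3 : K ≤ normalizer ((P : Subgroup K).map K.subtype : Set G) ⊔ frattini G := by
    have h4 := congrArg (Subgroup.map K.subtype) h2
    rw [← MonoidHom.range_eq_map, K.range_subtype] at h4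
    conv_lhs => rw [← h4]
    rw [Subgroup.map_sup, Subgroup.map_sup, Subgroup.map_subtype_commutator]
    have h5 := Subgroup.le_normalizer_map (H := (P : Subgroup K)) K.subtype
    refine sup_le (h5.trans le_sup_left)
      (sup_le (Subgroup.le_normalizer.trans le_sup_left) (h.trans le_sup_right))
  have h6 := frattini_nongenerating (G := G) (top_le_iff.1 (h1.ge.trans (sup_le le_sup_left h3)))
  exact (Subgroup.normalizer_eq_top_iff.1 h6).of_map_subtype

/-- `N` is a minimal normal subgroup of `G`. -/
structure IsMinimalNormal {G : Type*} [Group G] (N : Subgroup G) : Prop where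
  normal : N.Normal
  ne_bot : N ≠ ⊥
  eq_bot_or_eq : ∀ A : Subgroup G, A.Normal → A ≤ N → A = ⊥ ∨ A = N

theorem exists_isMinimalNormal (G : Type*) [Group G] [Finite G] [Nontrivial G] :
    ∃ N : Subgroup G, IsMinimalNormal N := by
  obtain ⟨N, ⟨hN, hne⟩, hmin⟩ := WellFounded.has_min (wellFounded_lt (α := Subgroup G))
    {A | A.Normal ∧ A ≠ ⊥} ⟨⊤, inferInstance, top_ne_bot⟩
  refine ⟨N, hN, hne, fun A hA hle => ?_⟩
  by_contra! hc
  exact hmin A ⟨hA, hc.1⟩ (lt_of_le_of_ne hle hc.2)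

/-- Otherwise `N = [N, K]` would lie in every term of the lower central series of `K`. -/
theorem IsMinimalNormal.commutator_eq_bot {G : Type*} [Group G] {N K : Subgroup G}
    (hN : IsMinimalNormal N) (hK : K.Normal) (hnil : Group.IsNilpotent K) : ⁅N, K⁆ = ⊥ := by
  have := hN.normal
  refine (hN.eq_bot_or_eq ⁅N, K⁆ inferInstance (Subgroup.commutator_le_left _ _)).resolve_right
    fun h => hN.ne_bot ?_
  obtain ⟨n, hn⟩ := (Subgroup.isNilpotent_iff_lowerCentralSeries K).1 hnil
  have key : ∀ m, N ≤ K.lowerCentralSeries m := by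
    intro m
    induction m with
    | zero => exact h ▸ Subgroup.commutator_le_right _ _
    | succ m ih =>
      rw [Subgroup.lowerCentralSeries_succ]
      conv_lhs => rw [← h]
      exact Subgroup.commutator_mono ih le_rfl
  exact le_bot_iff.1 (hn ▸ key n)

theorem IsMinimalNormal.map_mk {G : Type*} [Group G] {N R : Subgroup G} [R.Normal]
    (hN : IsMinimalNormal N) (hRN : R ⊓ N = ⊥) :
    IsMinimalNormal (N.map (QuotientGroup.mk' R)) ∧
      Nat.card (N.map (QuotientGroup.mk' R)) = Nat.card N := by
  have := hN.normal
  have hs := QuotientGroup.mk'_surjective R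
  have hcard : Nat.card (N.map (QuotientGroup.mk' R)) = Nat.card N := by
    rw [← Subgroup.relIndex_ker, QuotientGroup.ker_mk', ← Subgroup.inf_relIndex_right, hRN,
      Subgroup.relIndex_bot_left]
  refine ⟨⟨this.map _ hs, fun h => hN.ne_bot ?_, fun A hA hle => ?_⟩, hcard⟩
  · rw [Subgroup.map_eq_bot_iff, QuotientGroup.ker_mk'] at h
    rw [← hRN, inf_eq_right.2 h]
  · have := hA.comap (QuotientGroup.mk' R)
    rcases hN.eq_bot_or_eq (A.comap (QuotientGroup.mk' R) ⊓ N) inferInstance inf_le_right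
      with h | h
    · left
      rw [eq_bot_iff]
      intro a ha
      obtain ⟨n, hn, rfl⟩ := hle ha
      have h1 : n ∈ A.comap (QuotientGroup.mk' R) ⊓ N := ⟨ha, hn⟩
      rw [h, Subgroup.mem_bot] at h1
      rw [h1, map_one]
      exact one_mem _
    · exact Or.inr (le_antisymm hle (Subgroup.map_le_iff_le_comap.2 (inf_eq_right.1 h)))

theorem IsMinimalNormal.card_prime_of_zpowers_normal {G : Type*} [Group G] [Finite G]
    {N : Subgroup G} (hN : IsMinimalNormal N) (h : ∀ x ∈ N, (Subgroup.zpowers x).Normal) :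
    (Nat.card N).Prime := by
  obtain ⟨p, hp, hd⟩ := Nat.exists_prime_and_dvd
    (fun h => hN.ne_bot (Subgroup.card_eq_one.1 h) : Nat.card N ≠ 1)
  have := Fact.mk hp
  obtain ⟨x, hx⟩ := exists_prime_orderOf_dvd_card' p hd
  rcases hN.eq_bot_or_eq _ (h x x.2) (Subgroup.zpowers_le.2 x.2) with h1 | h1
  · rw [Subgroup.zpowers_eq_bot, OneMemClass.coe_eq_one] at h1
    rw [h1, orderOf_one] at hx
    exact absurd hx hp.one_lt.ne
  · rw [← h1, Nat.card_zpowers, Subgroup.orderOf_coe, hx]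
    exact hp

open Polynomial in
/-- An endomorphism of order dividing `p * (p - 1)` of a nontrivial elementary abelian `p`-group has
an eigenvector. -/
theorem exists_map_eq_pow_of_iterate {A : Type*} [CommGroup A] [Finite A] [Nontrivial A] (p : ℕ)
    [Fact p.Prime] (hexp : ∀ x : A, x ^ p = 1) (e : A →* A)
    (he : ∀ x, e^[p * (p - 1)] x = x) : ∃ x : A, x ≠ 1 ∧ ∃ a : ℕ, e x = x ^ a := by
  let _ : Module (ZMod p) (Additive A) := AddCommGroup.zmodModule (n := p) fun x => hexp x.toMul
  have : Module.Finite (ZMod p) (Additive A) := Module.Finite.of_finite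
  let T : Module.End (ZMod p) (Additive A) := (MonoidHom.toAdditive e).toZModLinearMap p
  have hp1 : 1 ≤ p := (Fact.out : p.Prime).one_le
  have hT : T ^ (p * (p - 1)) = 1 := by
    ext x
    rw [Module.End.pow_apply]
    exact he x.toMul
  -- In characteristic `p`, `(X^p - X)^p = X^p (X^(p(p-1)) - 1)`, which kills `T` and splits over
  -- `𝔽_p`.
  have hz : aeval T ((X ^ p - X : (ZMod p)[X]) ^ p) = 0 := by
    have h1 : (X ^ p - X : (ZMod p)[X]) ^ p = X ^ p * (X ^ (p * (p - 1)) - 1) := by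
      have h2 : (X ^ p - X : (ZMod p)[X]) = X * (X ^ (p - 1) - 1) := by
        rw [mul_sub, mul_one, ← pow_succ', Nat.sub_add_cancel hp1]
      rw [h2, mul_pow, sub_pow_char, one_pow, ← pow_mul, mul_comm (p - 1)]
    rw [h1, map_mul, map_sub, map_pow, aeval_X, map_pow, aeval_X, map_one, hT, sub_self, mul_zero]
  have hne : (X ^ p - X : (ZMod p)[X]) ^ p ≠ 0 :=
    pow_ne_zero _ (FiniteField.X_pow_card_sub_X_ne_zero _ (Fact.out : p.Prime).one_lt)
  have hsplit : (X ^ p - X : (ZMod p)[X]).Splits := by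
    have := FiniteField.splits_X_pow_card_sub_X (K := ZMod p) p
    simpa using this
  have hroot : ∃ μ, (minpoly (ZMod p) T).IsRoot μ := by
    have h1 : (minpoly (ZMod p) T).Splits :=
      (hsplit.pow p).of_dvd hne (minpoly.dvd _ _ hz)
    exact h1.exists_eval_eq_zero (minpoly.degree_pos (Algebra.IsIntegral.isIntegral T)).ne'
  obtain ⟨μ, hμ⟩ := hroot
  obtain ⟨v, hv⟩ := (Module.End.hasEigenvalue_of_isRoot hμ).exists_hasEigenvector
  refine ⟨v.toMul, fun h => hv.2 h, μ.val, ?_⟩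
  have h1 := hv.apply_eq_smul
  rw [← ZMod.natCast_zmod_val μ, Nat.cast_smul_eq_nsmul] at h1
  exact h1

theorem IsMinimalNormal.card_prime_of_commutator_eq_bot {G : Type*} [Group G] [Finite G]
    {N : Subgroup G} (hN : IsMinimalNormal N) {p : ℕ} [Fact p.Prime] (hexp : ∀ x ∈ N, x ^ p = 1)
    (hab : ⁅N, N⁆ = ⊥) (hD : ⁅N, commutator G⁆ = ⊥)
    (hg : ∀ g : G, ∀ x ∈ N, g ^ (p * (p - 1)) * x = x * g ^ (p * (p - 1))) :
    (Nat.card N).Prime := by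
  have hNn := hN.normal
  have hcN : ∀ x ∈ N, ∀ y ∈ N, x * y = y * x := fun x hx y hy => by
    have h1 : ⁅x, y⁆ ∈ (⊥ : Subgroup G) := hab ▸ Subgroup.commutator_mem_commutator hx hy
    exact commutatorElement_eq_one_iff_mul_comm.1 (Subgroup.mem_bot.1 h1)
  have hcD : ∀ x ∈ N, ∀ y ∈ commutator G, x * y = y * x := fun x hx y hy => by
    have h1 : ⁅x, y⁆ ∈ (⊥ : Subgroup G) := hD ▸ Subgroup.commutator_mem_commutator hx hy
    exact commutatorElement_eq_one_iff_mul_comm.1 (Subgroup.mem_bot.1 h1)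
  have hscalar : ∀ g : G, ∃ a : ℕ, ∀ x ∈ N, g * x * g⁻¹ = x ^ a := by
    intro g
    let _ : CommGroup N := { (inferInstance : Group N) with
      mul_comm := fun x y => Subtype.ext (hcN x x.2 y y.2) }
    have : Nontrivial N := (Subgroup.nontrivial_iff_ne_bot N).2 hN.ne_bot
    obtain ⟨x, hx1, a, hxa⟩ := exists_map_eq_pow_of_iterate (A := N) p
      (fun x => Subtype.ext (hexp x x.2)) (MulAut.conjNormal g : MulAut N).toMonoidHom (by
        intro x
        have h1 : ∀ m, ((MulAut.conjNormal g : MulAut N).toMonoidHom^[m] x : G) =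
            g ^ m * x * (g ^ m)⁻¹ := by
          intro m
          induction m with
          | zero => simp
          | succ m ih =>
            rw [Function.iterate_succ_apply']
            change ((MulAut.conjNormal g _ : N) : G) = _
            rw [MulAut.conjNormal_apply, ih, pow_succ']
            group
        refine Subtype.ext ?_
        rw [h1, hg g x x.2, mul_inv_cancel_right])
    have hxa' : g * (x : G) * g⁻¹ = (x : G) ^ a := by
      have := congrArg Subtype.val hxa
      simpa using this
    let E : Subgroup G :=
      { carrier := {y | y ∈ N ∧ g * y * g⁻¹ = y ^ a}
        one_mem' := ⟨N.one_mem, by simp⟩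
        mul_mem' := by
          rintro y z ⟨hy, hy'⟩ ⟨hz, hz'⟩
          refine ⟨N.mul_mem hy hz, ?_⟩
          have hc : Commute y z := hcN y hy z hz
          rw [hc.mul_pow, ← hy', ← hz']
          group
        inv_mem' := by
          rintro y ⟨hy, hy'⟩
          refine ⟨N.inv_mem hy, ?_⟩
          rw [inv_pow, ← hy']
          group }
    -- Conjugating `g` by `b` changes it only by an element of `G'`, which centralises `N`; so the
    -- eigenspace `E` is invariant under `G`.
    have hE : E.Normal := by
      refine ⟨fun y ⟨hy, hy'⟩ b => ⟨hNn.conj_mem y hy b, ?_⟩⟩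
      have h1 : (b⁻¹ * g * b * g⁻¹) ∈ commutator G := by
        have := Subgroup.commutator_mem_commutator (Subgroup.mem_top b⁻¹) (Subgroup.mem_top g)
        rwa [commutatorElement_def, inv_inv] at this
      have h2 := hcD _ (hNn.conj_mem y hy g) _ h1
      have h3 : g * (b * y * b⁻¹) * g⁻¹ =
          b * ((b⁻¹ * g * b * g⁻¹) * (g * y * g⁻¹)) * (b⁻¹ * g * b * g⁻¹)⁻¹ * b⁻¹ := by group
      rw [h3, ← h2, conj_pow, ← hy']
      group
    have hEN : E = N := (hN.eq_bot_or_eq E hE fun y hy => hy.1).resolve_left fun h => by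
      have h1 : (x : G) ∈ E := ⟨x.2, hxa'⟩
      rw [h, Subgroup.mem_bot, OneMemClass.coe_eq_one] at h1
      exact hx1 h1
    exact ⟨a, fun y hy => (hEN ▸ hy : y ∈ E).2⟩
  refine hN.card_prime_of_zpowers_normal fun x hx => ⟨?_⟩
  rintro _ ⟨m, rfl⟩ g
  obtain ⟨a, ha⟩ := hscalar g
  refine Subgroup.mem_zpowers_iff.2 ⟨a * m, ?_⟩
  rw [zpow_mul, zpow_natCast, ← ha x hx]
  simp only [conj_zpow]

theorem card_prime_of_isMinimalNormal {k : ℕ} (n : ℕ) : ∀ (G : Type u) [Group G] [Finite G],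
    Nat.card G = n → (∀ M : Subgroup G, IsCoatom M → IsModularlyEmbeddedUpTo k M) →
    ∀ N : Subgroup G, IsMinimalNormal N → (Nat.card N).Prime := by
  induction n using Nat.strong_induction_on with
  | _ n ih =>
  intro G _ _ hcG hG N hN
  have hNn := hN.normal
  have hDk : ∀ M : Subgroup G, IsCoatom M → ⁅commutator G, commutator G⁆ ≤ M := by
    intro M hM
    by_cases hMN : M.Normal
    · exact (Subgroup.commutator_le_left _ _).trans
        (Subgroup.commutator_le_of_isCoatom_of_normal hM hMN)
    · obtain ⟨L, -, -, hrel, hcomm, -⟩ := (hG M hM).exists_kernel hMN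
      have hp : (M.normalCore.relIndex L).Prime := hrel ▸ ((hG M hM).resolve_left hMN).1
      exact (Subgroup.commutator_mono hcomm hcomm).trans
        ((Subgroup.commutator_le_of_relIndex_prime M.normalCore_normal hp).trans M.normalCore_le)
  have hDnil : Group.IsNilpotent (commutator G) :=
    Subgroup.isNilpotent_of_commutator_le_frattini inferInstance (le_iInf₂ hDk)
  have hND : ⁅N, commutator G⁆ = ⊥ := hN.commutator_eq_bot inferInstance hDnil
  by_cases hle : N ≤ commutator G
  swap
  · have h1 : N ⊓ commutator G = ⊥ := (hN.eq_bot_or_eq _ inferInstance inf_le_left).resolve_right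
      fun h => hle (inf_eq_left.1 h)
    have h2 : ⁅N, (⊤ : Subgroup G)⁆ ≤ ⊥ := h1 ▸ le_inf (Subgroup.commutator_le_left _ _)
      (Subgroup.commutator_mono le_top le_rfl)
    refine hN.card_prime_of_zpowers_normal fun x hx => ⟨fun y hy g => ?_⟩
    have h3 : ⁅y, g⁆ ∈ (⊥ : Subgroup G) := h2 (Subgroup.commutator_mem_commutator
      (Subgroup.zpowers_le.2 hx hy) (Subgroup.mem_top g))
    rw [← commutatorElement_eq_one_iff_mul_comm.1 (Subgroup.mem_bot.1 h3), mul_inv_cancel_right]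
    exact hy
  have hab : ⁅N, N⁆ = ⊥ := le_bot_iff.1 (hND ▸ Subgroup.commutator_mono le_rfl hle)
  have hcN : ∀ x ∈ N, ∀ y ∈ N, x * y = y * x := fun x hx y hy => by
    have h1 : ⁅x, y⁆ ∈ (⊥ : Subgroup G) := hab ▸ Subgroup.commutator_mem_commutator hx hy
    exact commutatorElement_eq_one_iff_mul_comm.1 (Subgroup.mem_bot.1 h1)
  obtain ⟨p, hp, hpd⟩ := Nat.exists_prime_and_dvd
    (fun h => hN.ne_bot (Subgroup.card_eq_one.1 h) : Nat.card N ≠ 1)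
  have := Fact.mk hp
  have hexp : ∀ x ∈ N, x ^ p = 1 := by
    let E : Subgroup G :=
      { carrier := {y | y ∈ N ∧ y ^ p = 1}
        one_mem' := ⟨N.one_mem, one_pow p⟩
        mul_mem' := by
          rintro y z ⟨hy, hy'⟩ ⟨hz, hz'⟩
          have hc : Commute y z := hcN y hy z hz
          exact ⟨N.mul_mem hy hz, by rw [hc.mul_pow, hy', hz', one_mul]⟩
        inv_mem' := by
          rintro y ⟨hy, hy'⟩
          exact ⟨N.inv_mem hy, by rw [inv_pow, hy', inv_one]⟩ }
    have hE : E.Normal := ⟨fun y ⟨hy, hy'⟩ b =>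
      ⟨hNn.conj_mem y hy b, by rw [conj_pow, hy', mul_one, mul_inv_cancel]⟩⟩
    obtain ⟨x, hx⟩ := exists_prime_orderOf_dvd_card' p hpd
    have hEN : E = N := (hN.eq_bot_or_eq E hE fun y hy => hy.1).resolve_left fun h => by
      have h1 : (x : G) ∈ E := ⟨x.2, by
        rw [← Subgroup.coe_pow, ← hx, pow_orderOf_eq_one, Subgroup.coe_one]⟩
      rw [h, Subgroup.mem_bot, OneMemClass.coe_eq_one] at h1
      rw [h1, orderOf_one] at hx
      exact hp.one_lt.ne hx
    exact fun y hy => (hEN ▸ hy : y ∈ E).2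
  -- A maximal subgroup not containing the abelian `N` is a complement of it, and its index is
  -- prime.
  by_cases hΦ : ∃ M : Subgroup G, IsCoatom M ∧ ¬ N ≤ M
  · obtain ⟨M, hM, hNM⟩ := hΦ
    have hsup : M ⊔ N = ⊤ := hM.2 _ (left_lt_sup.2 hNM)
    have hinf : (M ⊓ N).Normal := by
      refine ⟨fun a ha g => ?_⟩
      obtain ⟨m, hm, x, hx, rfl⟩ := Subgroup.mem_sup_of_normal_right.1
        (hsup ▸ Subgroup.mem_top g : g ∈ M ⊔ N)
      have h1 : m * x * a * (m * x)⁻¹ = m * a * m⁻¹ := by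
        rw [mul_assoc m, hcN x hx a ha.2]
        group
      rw [h1]
      exact ⟨M.mul_mem (M.mul_mem hm ha.1) (M.inv_mem hm), hNn.conj_mem a ha.2 m⟩
    have hbot : M ⊓ N = ⊥ := (hN.eq_bot_or_eq _ hinf inf_le_right).resolve_right
      fun h => hNM (inf_eq_right.1 h)
    have hcard : Nat.card N = M.index := by
      have e1 := Subgroup.relIndex_sup_right M N
      rw [hsup, Subgroup.relIndex_top_right, ← Subgroup.inf_relIndex_left, hbot,
        Subgroup.relIndex_bot_left] at e1
      have e2 := N.card_mul_index
      rw [e1, ← M.card_mul_index, mul_comm] at e2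
      exact Nat.eq_of_mul_eq_mul_left Nat.card_pos e2
    rw [hcard]
    exact (hG M hM).index_prime hM
  -- A Sylow `r`-subgroup of the nilpotent group `G'` is normal in `G` and meets the `p`-group `N`
  -- trivially, so induction applies to the quotient by it.
  by_cases hr : ∃ r : ℕ, r.Prime ∧ r ≠ p ∧ r ∣ Nat.card (commutator G)
  · obtain ⟨r, hr, hrp, hrd⟩ := hr
    have := Fact.mk hr
    let P : Sylow r (commutator G) := default
    have hPn : (P : Subgroup (commutator G)).Normal := inferInstance
    have hPc : (P : Subgroup (commutator G)).Characteristic := P.characteristic_of_normal hPn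
    set R : Subgroup G := (P : Subgroup (commutator G)).map (commutator G).subtype with hR
    have hRn : R.Normal := inferInstance
    have hRN : R ⊓ N = ⊥ := by
      rw [eq_bot_iff]
      rintro x ⟨⟨⟨y, hy'⟩, hy, hyx⟩, hxN⟩
      obtain ⟨j, hj⟩ := P.2 ⟨⟨y, hy'⟩, hy⟩
      have hj' : x ^ r ^ j = 1 := by
        rw [← hyx]
        exact congrArg (fun z : P => ((z : commutator G) : G)) hj
      have h1 := Nat.dvd_gcd (orderOf_dvd_of_pow_eq_one hj')
        (orderOf_dvd_of_pow_eq_one (hexp x hxN))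
      rw [Nat.Coprime.gcd_eq_one (Nat.Coprime.pow_left j ((Nat.coprime_primes hr hp).2 hrp)),
        Nat.dvd_one, orderOf_eq_one_iff] at h1
      rw [h1]
      exact one_mem _
    have hRne : R ≠ ⊥ := fun h => P.ne_bot_of_dvd_card hrd <| by
      rwa [hR, Subgroup.map_eq_bot_iff, Subgroup.ker_subtype, le_bot_iff] at h
    obtain ⟨h1, h2⟩ := hN.map_mk hRN
    rw [← h2]
    refine ih (Nat.card (G ⧸ R)) ?_ (G ⧸ R) rfl ?_ _ h1
    · rw [← hcG, Subgroup.card_eq_card_quotient_mul_card_subgroup R]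
      refine lt_mul_of_one_lt_right Nat.card_pos ?_
      exact lt_of_le_of_ne Nat.card_pos (fun h => hRne (Subgroup.card_eq_one.1 h.symm))
    · intro M hM
      have hs := QuotientGroup.mk'_surjective R
      exact .of_comap hs (hG _ (Subgroup.isCoatom_comap_of_surjective hs hM))
  · push Not at hr
    refine hN.card_prime_of_commutator_eq_bot hexp hab hND fun g x hx => ?_
    -- Now `p` is the only possible prime divisor of `|G'|`. If `|G : M| = p`, the exponent of `G /
    -- Core(M)` divides `p * (p - 1)`; for any other index `G' ≤ M`. So `g ^ (p * (p - 1))` is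
    -- central modulo `Φ(G)`.
    have hcore : ∀ M : Subgroup G, IsCoatom M → ∀ z : G, ⁅z, g ^ (p * (p - 1))⁆ ∈ M := by
      intro M hM z
      by_cases hMp : M.index = p
      · have hmem : g ^ (p * (p - 1)) ∈ M.normalCore := by
          by_cases hMN : M.Normal
          · rw [M.normalCore_eq_self, pow_mul]
            exact M.pow_mem (hMp ▸ M.pow_index_mem g) _
          · obtain ⟨L, -, hL, hrel, -, hd, -⟩ := (hG M hM).exists_kernel hMN
            have h1 : M.normalCore.index ∣ p * (p - 1) := by
              rw [← Subgroup.relIndex_mul_index hL, hrel, hMp]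
              exact Nat.mul_dvd_mul_left p (hMp ▸ hd)
            obtain ⟨c, hc⟩ := h1
            rw [hc, pow_mul]
            exact Subgroup.pow_mem _ (M.normalCore.pow_index_mem g) _
        have h2 : ⁅z, g ^ (p * (p - 1))⁆ ∈ M.normalCore := by
          rw [commutatorElement_def]
          exact mul_mem (M.normalCore_normal.conj_mem _ hmem z) (inv_mem hmem)
        exact M.normalCore_le h2
      · have hz : ⁅z, g ^ (p * (p - 1))⁆ ∈ commutator G :=
          Subgroup.commutator_mem_commutator (Subgroup.mem_top z) (Subgroup.mem_top _)
        by_cases hMN : M.Normal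
        · exact Subgroup.commutator_le_of_isCoatom_of_normal hM hMN hz
        · obtain ⟨L, -, hL, hrel, hcomm, -⟩ := (hG M hM).exists_kernel hMN
          have hip := ((hG M hM).resolve_left hMN).1
          have h1 := M.normalCore_normal.relIndex_dvd_relIndex hcomm
          rw [hrel] at h1
          rcases (Nat.dvd_prime hip).1 h1 with h2 | h2
          · exact M.normalCore_le (Subgroup.relIndex_eq_one.1 h2 hz)
          · refine absurd ?_ (hr _ hip hMp)
            rw [← h2]
            exact Subgroup.relIndex_dvd_card _ _
    -- The preimage of the centre of `G / Φ(G)` is nilpotent, hence centralises `N`.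
    let K : Subgroup G := (Subgroup.center (G ⧸ frattini G)).comap (QuotientGroup.mk' (frattini G))
    have hmk : ∀ a b : G, ⁅a, b⁆ ∈ frattini G ↔
        QuotientGroup.mk' (frattini G) a * QuotientGroup.mk' (frattini G) b =
        QuotientGroup.mk' (frattini G) b * QuotientGroup.mk' (frattini G) a := by
      intro a b
      rw [← commutatorElement_eq_one_iff_mul_comm, ← map_commutatorElement, ← MonoidHom.mem_ker,
        QuotientGroup.ker_mk']
    have hK : ⁅K, K⁆ ≤ frattini G := by
      rw [Subgroup.commutator_le]
      intro a ha b hb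
      rw [hmk]
      exact Subgroup.mem_center_iff.1 (Subgroup.mem_comap.1 hb) _
    have hy : g ^ (p * (p - 1)) ∈ K := by
      rw [Subgroup.mem_comap, Subgroup.mem_center_iff]
      intro z
      obtain ⟨z, rfl⟩ := QuotientGroup.mk'_surjective (frattini G) z
      rw [← hmk]
      have hle : Subgroup.zpowers ⁅z, g ^ (p * (p - 1))⁆ ≤ frattini G := by
        refine le_iInf₂ fun M hM => ?_
        exact Subgroup.zpowers_le.2 (hcore M hM z)
      exact Subgroup.zpowers_le.1 hle
    have hKn : K.Normal := inferInstance
    have hNK := hN.commutator_eq_bot hKn (Subgroup.isNilpotent_of_commutator_le_frattini hKn hK)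
    have h1 : ⁅x, g ^ (p * (p - 1))⁆ ∈ (⊥ : Subgroup G) :=
      hNK ▸ Subgroup.commutator_mem_commutator hx hy
    exact (commutatorElement_eq_one_iff_mul_comm.1 (Subgroup.mem_bot.1 h1)).symm

/-- `R / S` is a section of prime order between normal subgroups. -/
def PrimeStep {G : Type u} [Group G] (S R : Subgroup G) : Prop :=
  S.Normal ∧ R.Normal ∧ S ≤ R ∧ (S.relIndex R).Prime

theorem PrimeStep.comap {G₁ G₂ : Type u} [Group G₁] [Group G₂] {S R : Subgroup G₂}
    (h : PrimeStep S R) {f : G₁ →* G₂} (hf : Function.Surjective f) :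
    PrimeStep (S.comap f) (R.comap f) :=
  ⟨h.1.comap f, h.2.1.comap f, Subgroup.comap_mono h.2.2.1, by
    rw [Subgroup.relIndex_comap, Subgroup.map_comap_eq_self_of_surjective hf]; exact h.2.2.2⟩

theorem IsSupersoluble.of_primeStep {G : Type u} [Group G]
    (h : Relation.ReflTransGen PrimeStep (⊥ : Subgroup G) ⊤) : IsSupersoluble G := by
  obtain ⟨m, c, h0, hm, hc⟩ := h.exists_seq
  -- Supersolubility asks for normality at every index, so the sequence is made `⊤` beyond `m`.
  obtain ⟨d, hd, hd'⟩ : ∃ d : ℕ → Subgroup G, (∀ i ≤ m, d i = c i) ∧ ∀ i, m < i → d i = ⊤ :=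
    ⟨fun i => if i ≤ m then c i else ⊤, fun i hi => if_pos hi, fun i hi => if_neg (not_le.2 hi)⟩
  refine ⟨m, d, fun i => ?_, (hd 0 m.zero_le).trans h0, (hd m le_rfl).trans hm, fun i hi => ?_⟩
  · rcases lt_trichotomy i m with hi | rfl | hi
    · exact hd i hi.le ▸ (hc i hi).1
    · rw [hd i le_rfl, hm]
      infer_instance
    · rw [hd' i hi]
      infer_instance
  · have h1 := hc i hi
    rw [← hd i hi.le, ← hd (i + 1) hi] at h1
    have := Fact.mk h1.2.2.2
    have := h1.1.subgroupOf (d (i + 1))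
    exact ⟨h1.2.2.1, isCyclic_of_prime_card (p := (d i).relIndex (d (i + 1))) rfl⟩

theorem primeStep_bot_top {k : ℕ} (n : ℕ) : ∀ (G : Type u) [Group G] [Finite G], Nat.card G = n →
    (∀ M : Subgroup G, IsCoatom M → IsModularlyEmbeddedUpTo k M) →
    Relation.ReflTransGen PrimeStep (⊥ : Subgroup G) ⊤ := by
  induction n using Nat.strong_induction_on with
  | _ n ih =>
  intro G _ _ hcG hG
  rcases subsingleton_or_nontrivial G with hs | hs
  · rw [Subsingleton.elim (⊥ : Subgroup G) ⊤]
  obtain ⟨N, hN⟩ := exists_isMinimalNormal G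
  have hp := card_prime_of_isMinimalNormal _ G rfl hG N hN
  have hNn := hN.normal
  have hs := QuotientGroup.mk'_surjective N
  have h1 := ih (Nat.card (G ⧸ N)) ?_ (G ⧸ N) rfl fun M hM =>
    .of_comap hs (hG _ (Subgroup.isCoatom_comap_of_surjective hs hM))
  · have h2 := h1.lift (Subgroup.comap (QuotientGroup.mk' N)) fun A B hAB => hAB.comap hs
    refine .head (b := N) ⟨inferInstance, hNn, bot_le, ?_⟩ ?_
    · rwa [Subgroup.relIndex_bot_left]
    · change Relation.ReflTransGen _ (Subgroup.comap _ ⊥) (Subgroup.comap _ ⊤) at h2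
      rwa [MonoidHom.comap_bot, QuotientGroup.ker_mk', Subgroup.comap_top] at h2
  · rw [← hcG, Subgroup.card_eq_card_quotient_mul_card_subgroup N]
    exact lt_mul_of_one_lt_right Nat.card_pos hp.one_lt

/-! ### Section chains in groups of 𝔜. -/

/-- `Aut N` is cyclic, so a single `g` induces the whole action of `G`. If the action is nontrivial,
`H = ⟨g⟩` meets `N` trivially and is maximal in `HN`, hence modularly embedded there. Normal
subgroups of `HN` inside `H` centralise `N`, so `|G : C(N)| = |H : C_H(N)|` divides `|H : Core(H)|`,
the core being taken in `HN`. -/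
theorem sectionStep_bot_of_card_prime {G : Type u} [Group G] [Finite G] {k : ℕ} (hk : 1 ≤ k)
    (hG : ∀ H : Subgroup G, IsKSubmodular k H) {N : Subgroup G} (hN : N.Normal)
    (hp : (Nat.card N).Prime) : SectionStep k ⊥ N := by
  refine ⟨inferInstance, hN, bot_le, ?_⟩
  have := Fact.mk hp
  have hcyc : IsCyclic N := isCyclic_of_prime_card rfl
  let ψ : G →* (ZMod (Nat.card N))ˣ :=
    (IsCyclic.mulAutMulEquiv N).toMonoidHom.comp MulAut.conjNormal
  have hker : ∀ g, g ∈ ψ.ker ↔ ∀ x ∈ N, g * x * g⁻¹ = x := by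
    intro g
    simp only [ψ, MonoidHom.mem_ker, MonoidHom.comp_apply, MulEquiv.coe_toMonoidHom,
      map_eq_one_iff _ (IsCyclic.mulAutMulEquiv N).injective]
    constructor
    · intro h x hx
      have := congrArg (fun e : MulAut N => ((e ⟨x, hx⟩ : N) : G)) h
      simpa using this
    · intro h
      ext x
      simpa using h x x.2
  have hcomm : ∀ C : Subgroup G, C ≤ ψ.ker → ⁅N, C⁆ ≤ ⊥ := by
    intro C hC
    rw [Subgroup.commutator_le]
    intro x hx c hc
    have h1 := mul_inv_eq_iff_eq_mul.1 ((hker c).1 (hC hc) x hx)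
    rw [Subgroup.mem_bot, commutatorElement_eq_one_iff_mul_comm, h1]
  by_cases htop : ψ.ker = ⊤
  · exact Or.inl (hcomm ⊤ htop.ge)
  obtain ⟨⟨_, g, rfl⟩, hg⟩ := IsCyclic.exists_generator (α := ψ.range)
  have hgen : ∀ x : G, ∃ i : ℤ, x * (g ^ i)⁻¹ ∈ ψ.ker := by
    intro x
    obtain ⟨i, hi⟩ := Subgroup.mem_zpowers_iff.1 (hg ⟨ψ x, x, rfl⟩)
    refine ⟨i, ?_⟩
    have := congrArg Subtype.val hi
    simp only [Subgroup.coe_zpow] at this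
    rw [MonoidHom.mem_ker, map_mul, map_inv, map_zpow, this, mul_inv_cancel]
  set H := Subgroup.zpowers g with hH
  have hNH : H ⊓ N = ⊥ := by
    by_contra hne
    have h1 : N ≤ H := by
      rcases (Nat.dvd_prime hp).1 (Subgroup.card_dvd_of_le (inf_le_right : H ⊓ N ≤ N)) with h | h
      · exact absurd (Subgroup.card_eq_one.1 h) hne
      · exact inf_eq_right.1 (Subgroup.eq_of_le_of_card_ge inf_le_right h.ge)
    refine htop ((Subgroup.eq_top_iff' _).2 fun x => ?_)
    obtain ⟨i, hi⟩ := hgen x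
    have h2 : g ∈ ψ.ker := by
      rw [hker]
      intro y hy
      obtain ⟨j, rfl⟩ := Subgroup.mem_zpowers_iff.1 (h1 hy)
      group
    have := ψ.ker.mul_mem hi (ψ.ker.zpow_mem h2 i)
    rwa [inv_mul_cancel_right] at this
  have hidx : H.relIndex (H ⊔ N) = Nat.card N := by
    have e1 := Subgroup.relIndex_mul_relIndex ⊥ H (H ⊔ N) bot_le le_sup_left
    have e2 := Subgroup.relIndex_mul_relIndex ⊥ N (H ⊔ N) bot_le le_sup_right
    rw [Subgroup.relIndex_sup_right, ← Subgroup.inf_relIndex_left H N, hNH, ← e1, mul_comm,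
      Subgroup.relIndex_bot_left, Subgroup.relIndex_bot_left] at e2
    exact (Nat.eq_of_mul_eq_mul_left Nat.card_pos e2).symm
  have hidx' : (H.subgroupOf (H ⊔ N)).index = Nat.card N := hidx
  have hME := (isKSubmodular_iff_of_isCoatom hk (Subgroup.isCoatom_of_index_prime
    (hidx' ▸ hp))).1 ((hG H).comap hk (H ⊔ N).subtype)
  change IsModularlyEmbeddedUpTo k (H.subgroupOf (H ⊔ N)) at hME
  have hker_of : ∀ A : Subgroup ↥(H ⊔ N), A.Normal → A ≤ H.subgroupOf (H ⊔ N) →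
      ∀ a ∈ A, (a : G) ∈ ψ.ker := by
    intro A hA hAH a ha
    rw [hker]
    intro x hx
    let x' : ↥(H ⊔ N) := ⟨x, le_sup_right (a := H) hx⟩
    have h1 : (a * x' * a⁻¹ * x'⁻¹ : ↥(H ⊔ N)) ∈ A := by
      have := A.mul_mem ha (hA.conj_mem _ (A.inv_mem ha) x')
      simpa [mul_assoc] using this
    have h2 : ((a * x' * a⁻¹ * x'⁻¹ : ↥(H ⊔ N)) : G) ∈ H ⊓ N :=
      ⟨hAH h1, N.mul_mem (hN.conj_mem x hx a) (N.inv_mem hx)⟩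
    rw [hNH, Subgroup.mem_bot] at h2
    exact mul_inv_eq_one.1 h2
  have hHker : ψ.ker.relIndex H = ψ.ker.index := by
    have h1 : H ⊔ ψ.ker = ⊤ := by
      rw [Subgroup.eq_top_iff']
      intro x
      obtain ⟨i, hi⟩ := hgen x
      have := (H ⊔ ψ.ker).mul_mem (le_sup_right (a := H) hi)
        (le_sup_left (b := ψ.ker) (H.zpow_mem (Subgroup.mem_zpowers g) i))
      rwa [inv_mul_cancel_right] at this
    rw [← Subgroup.relIndex_sup_right H, h1, Subgroup.relIndex_top_right]
  rcases hME with hn | ⟨-, q, hq, hd⟩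
  · refine absurd ?_ htop
    rw [← Subgroup.index_eq_one, ← hHker, Subgroup.relIndex_eq_one]
    intro h hh
    exact hker_of _ hn le_rfl ⟨h, le_sup_left (b := N) hh⟩ hh
  · refine Or.inr ⟨by rwa [Subgroup.relIndex_bot_left], q, ψ.ker, hq, inferInstance, bot_le,
      hcomm _ le_rfl, ?_⟩
    rw [← hHker, ← Subgroup.relIndex_subgroupOf (le_sup_left : H ≤ H ⊔ N)]
    refine (Subgroup.relIndex_dvd_of_le_left _ ?_).trans hd
    intro a ha
    exact hker_of _ (Subgroup.normalCore_normal _) (Subgroup.normalCore_le _) a ha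

theorem hasSectionChain_bot {k : ℕ} (hk : 1 ≤ k) (n : ℕ) : ∀ (G : Type u) [Group G] [Finite G],
    Nat.card G = n → (∀ H : Subgroup G, IsKSubmodular k H) →
    HasSectionChain k (⊥ : Subgroup G) := by
  induction n using Nat.strong_induction_on with
  | _ n ih =>
  intro G _ _ hcG hG
  rcases subsingleton_or_nontrivial G with hs | hs
  · rw [Subsingleton.elim (⊥ : Subgroup G) ⊤]
    exact .refl
  obtain ⟨N, hN⟩ := exists_isMinimalNormal G
  have hp := card_prime_of_isMinimalNormal _ G rfl
    (fun M hM => (isKSubmodular_iff_of_isCoatom hk hM).1 (hG M)) N hN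
  have hNn := hN.normal
  have h1 := ih (Nat.card (G ⧸ N)) ?_ (G ⧸ N) rfl fun H =>
    .of_comap hk (QuotientGroup.mk'_surjective N) (hG _)
  · have h2 := h1.comap (QuotientGroup.mk' N)
    rw [MonoidHom.comap_bot, QuotientGroup.ker_mk'] at h2
    exact .head (sectionStep_bot_of_card_prime hk hG hNn hp) h2
  · rw [← hcG, Subgroup.card_eq_card_quotient_mul_card_subgroup N]
    exact lt_mul_of_one_lt_right Nat.card_pos hp.one_lt

/-! ### The classes 𝔛 and 𝔜. -/

theorem classY_quotient_iff {k : ℕ} (hk : 1 ≤ k) {G : Type u} [Group G] [Finite G]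
    (N : Subgroup G) [N.Normal] : ClassY k (G ⧸ N) ↔ HasSectionChain k N := by
  constructor
  · intro h
    have h1 := (hasSectionChain_bot hk _ (G ⧸ N) rfl h).comap (QuotientGroup.mk' N)
    rwa [MonoidHom.comap_bot, QuotientGroup.ker_mk'] at h1
  · intro h H
    refine .of_comap hk (QuotientGroup.mk'_surjective N) (h.isKSubmodular hk ?_)
    conv_lhs => rw [← QuotientGroup.ker_mk' N]
    exact Subgroup.ker_le_comap _ _

theorem ClassX.of_surjective {k : ℕ} (hk : 1 ≤ k) {G K : Type u} [Group G] [Finite G] [Group K]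
    [Finite K] {f : G →* K} (hf : Function.Surjective f) (h : ClassX k G) : ClassX k K :=
  fun _ hM => .of_comap hk hf (h _ (Subgroup.isCoatom_comap_of_surjective hf hM))

theorem ClassY.of_surjective {k : ℕ} (hk : 1 ≤ k) {G K : Type u} [Group G] [Finite G] [Group K]
    [Finite K] {f : G →* K} (hf : Function.Surjective f) (h : ClassY k G) : ClassY k K :=
  fun _ => .of_comap hk hf (h _)

/-- A maximal subgroup containing `N` is `k`-submodular if its image modulo `N` is. -/
theorem IsKSubmodular.of_classX_quotient {k : ℕ} (hk : 1 ≤ k) {G : Type u} [Group G] [Finite G]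
    {N M : Subgroup G} [N.Normal] (hNM : N ≤ M) (hM : IsCoatom M) (h : ClassX k (G ⧸ N)) :
    IsKSubmodular k M := by
  have hs := QuotientGroup.mk'_surjective N
  have hcm : (M.map (QuotientGroup.mk' N)).comap (QuotientGroup.mk' N) = M :=
    Subgroup.comap_map_eq_self (by rwa [QuotientGroup.ker_mk'])
  have hco : IsCoatom (M.map (QuotientGroup.mk' N)) := by
    refine ⟨fun h1 => hM.1 ?_, fun A hA => ?_⟩
    · rw [← hcm, h1, Subgroup.comap_top]
    · have h1 : M < A.comap (QuotientGroup.mk' N) := by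
        conv_lhs => rw [← hcm]
        exact (Subgroup.comap_lt_comap_of_surjective hs).2 hA
      rw [← Subgroup.map_comap_eq_self_of_surjective hs A, hM.2 _ h1,
        Subgroup.map_top_of_surjective _ hs]
  rw [← hcm]
  exact (h _ hco).comap hk _

theorem theorem3 (k : ℕ) (hk : 1 ≤ k) :
    (IsSchunckClass.{u} (ClassX k) ∧
      ∀ (G : Type u) [Group G] [Finite G], ClassX k G → IsSupersoluble G) ∧
    (IsFormation.{u} (ClassY k) ∧ IsHereditary.{u} (ClassY k)) ∧
    (∀ (G : Type u) [Group G] [Finite G], ClassX k G ↔ ClassY k (G ⧸ frattini G)) := by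
  have hX : ∀ (G : Type u) [Group G] [Finite G], ClassX k G →
      ∀ M : Subgroup G, IsCoatom M → IsModularlyEmbeddedUpTo k M := fun G _ _ h M hM =>
    (isKSubmodular_iff_of_isCoatom hk hM).1 (h M hM)
  refine ⟨⟨⟨⟨?_, ?_⟩, ?_⟩, ?_⟩, ⟨⟨⟨?_, ?_⟩, ?_⟩, ?_⟩, ?_⟩
  · rintro G K _ _ _ _ ⟨e⟩ h
    exact ClassX.of_surjective (f := e.toMonoidHom) hk e.surjective h
  · intro G _ _ N _ h
    exact ClassX.of_surjective hk (QuotientGroup.mk'_surjective N) h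
  · intro G _ _ h M hM
    exact .of_classX_quotient hk M.normalCore_le hM (h M hM)
  · intro G _ _ h
    exact .of_primeStep (primeStep_bot_top _ G rfl (hX G h))
  · rintro G K _ _ _ _ ⟨e⟩ h
    exact ClassY.of_surjective (f := e.toMonoidHom) hk e.surjective h
  · intro G _ _ N _ h
    exact ClassY.of_surjective hk (QuotientGroup.mk'_surjective N) h
  · intro G _ _ N₁ N₂ _ _ h₁ h₂
    rw [classY_quotient_iff hk] at h₁ h₂ ⊢
    exact h₁.inf inferInstance h₂
  · intro G _ _ H h A
    have hA : (A.map H.subtype).comap H.subtype = A :=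
      Subgroup.comap_map_eq_self_of_injective H.subtype_injective A
    rw [← hA]
    exact (h _).comap hk _
  · intro G _ _
    refine ⟨fun h => (classY_quotient_iff hk _).2 (hasSectionChain_frattini (hX G h)),
      fun h M hM => ?_⟩
    exact .of_classX_quotient hk (frattini_le_coatom hM) hM fun A _ => h A
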